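/- Consider a two-sided market with $n$ customers and $m$ suppliers. Every agent $a$ has a choice model: shown an assortment $S$ of agents of the opposite side, $a$ chooses $b\in S\cup\{0\}$ with probability $\phi_a(b,S)$ ($0$ is the outside option), independently of the other agents. A policy processes the agents one by one, each exactly once; processing an agent means showing it one assortment, and the policy, which may randomize, can use all answers observed before. A match is a customer and a supplier who chose each other. For a class of policies, $\mathrm{OPT}$ is the supremum of the expected number of matches. In ($\mathcal C$-One-sided Adaptive) all customers (the initiating side) are processed before all suppliers (the responding side), in ($\mathcal S$-One-sided Adaptive) all suppliers are processed before all customers, and in (Fully Adaptive) the order is arbitrary. Each agent $a$ has a bound $K_a\in\{1,2,\dots\}$. The backlog of $a$ is the set of agents that have already chosen $a$. A choice model is weakly substitutable if $\phi_a(b,S)\ge\phi_a(b,S')$ for all $S\subseteq S'$ and $b\in S\cup\{0\}$. In each of the following two cases there are polynomial-time randomized algorithms that carry out feasible policies with, in expectation, at least $\frac12\mathrm{OPT}$ matches for ($\mathcal C$-One-sided Adaptive), at least $\frac12\mathrm{OPT}$ matches for ($\mathcal S$-One-sided Adaptive), and at least $\frac14\mathrm{OPT}$ matches for (Fully Adaptive).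 (1) Two-way constrained setting with MNL choice models: every assortment shown to an agent $a$ has at most $K_a$ elements, and $\phi_a(b,S)=u_{ab}/(1+\sum_{c\in S}u_{ac})$ for $b\in S$ and $\phi_a(0,S)=1/(1+\sum_{c\in S}u_{ac})$, with weights $u_{ab}\ge 0$ that are given as the input. (2) One-way constrained setting, with arbitrary choice models, weakly substitutable or not, such that the demand function $f_a(S)=\sum_{b\in S}\phi_a(b,S)$ of every agent is monotone and submodular. The algorithm can query the values $\phi_a(b,S)$ and, for every agent $a$ that may initiate and all $\theta\ge 0$, an oracle for an optimal solution of $\max\{\sum_{b\in S}\theta_b\phi_a(b,S):|S|\le K_a\}$. An initiating agent $a$ is shown at most $K_a$ agents; for responding agents there is no cardinality constraint, but a responding agent whose choice model is not weakly substitutable is shown only agents of its backlog. In (Fully Adaptive) this means: when $a$ is processed, at most $K_a$ of the agents shown to it have not been processed yet, and if the choice model of $a$ is not weakly substitutable, then the agents shown to it are either all unprocessed ($a$ initiates) or all in its backlog ($a$ responds). Here polynomial time means that the number of elementary steps (arithmetic operations and comparisons of real numbers, operations on indices and counters, coin flips, displays and oracle calls) of one program, the same for all markets, is bounded by a polynomial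 in $n+m$. -/

import Mathlib

namespace TwoSided

noncomputable section

/-! ### Agents, choice models, demand functions -/

/-- The agents of a market with `n` customers (`Sum.inl`) and `m` suppliers (`Sum.inr`). -/
abbrev Agent (n m : ℕ) := Fin n ⊕ Fin m

variable {n m : ℕ}

/-- The agents on the side opposite to `a`. -/
def opposite (a : Agent n m) : Finset (Agent n m) :=
  Finset.univ.filter fun b => b.isLeft ≠ a.isLeft

/-- `φ a S o` is the probability that agent `a`, shown the assortment `S`, answers `o`, where
`some b` means choosing `b` and `none` is the outside option. Only `S ⊆ opposite a` matters. -/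
abbrev Choice (n m : ℕ) := Agent n m → Finset (Agent n m) → Option (Agent n m) → ℝ

/-- Every agent's answers form a probability distribution on the assortment together with the
outside option. -/
def IsChoiceModel (φ : Choice n m) : Prop :=
  ∀ a, ∀ S ⊆ opposite a,
    (∀ o, 0 ≤ φ a S o) ∧ ∑ o, φ a S o = 1 ∧ ∀ b ∉ S, φ a S (some b) = 0

/-- The (unconstrained) demand function: the probability that `a` chooses somebody from `S`. -/
def demand (φ : Choice n m) (a : Agent n m) (S : Finset (Agent n m)) : ℝ :=
  ∑ b ∈ S, φ a S (some b)

/-- The demand function of every agent is a monotone submodular set function. -/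
def MonotoneSubmodularDemand (φ : Choice n m) : Prop :=
  ∀ a,
    (∀ S T, S ⊆ T → T ⊆ opposite a → demand φ a S ≤ demand φ a T) ∧
    (∀ S T, S ⊆ T → T ⊆ opposite a → ∀ e ∈ opposite a, e ∉ T →
      demand φ a (insert e T) - demand φ a T ≤ demand φ a (insert e S) - demand φ a S)

/-- Weak substitutability of the choice model of the agent `a`. -/
def WeaklySubstitutable (φ : Choice n m) (a : Agent n m) : Prop :=
  ∀ S T, S ⊆ T → T ⊆ opposite a →
    φ a T none ≤ φ a S none ∧ ∀ b ∈ S, φ a T (some b) ≤ φ a S (some b)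

/-- The multinomial logit choice model in which agent `a` has preference weight `u a b` for `b`
and weight `1` for the outside option. -/
def mnl (u : Agent n m → Agent n m → ℝ) : Choice n m := fun a S o =>
  match o with
  | none => 1 / (1 + ∑ c ∈ S, u a c)
  | some b => if b ∈ S then u a b / (1 + ∑ c ∈ S, u a c) else 0

/-! ### Policies -/

/-- What has been observed so far: `h a = none` if `a` has not been processed yet, and
`h a = some o` if `a` has been processed and answered `o`. -/
abbrev History (n m : ℕ) := Agent n m → Option (Option (Agent n m))

/-- Nobody has been processed. -/
def History.init : History n m := fun _ => none

/-- The history after `a` has been processed and has answered `o`. -/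
def History.record (h : History n m) (a : Agent n m) (o : Option (Agent n m)) : History n m :=
  Function.update h a (some o)

/-- Number of matches: customer-supplier pairs that chose each other. -/
def History.matches (h : History n m) : ℕ :=
  (Finset.univ.filter fun p : Fin n × Fin m =>
    h (Sum.inl p.1) = some (some (Sum.inr p.2)) ∧
    h (Sum.inr p.2) = some (some (Sum.inl p.1))).card

/-- Randomized adaptive policies that process the agents one by one, as decision trees.
`mix p π σ` continues as `π` with probability `p` and as `σ` with probability `1 - p`;
`display a S k` processes `a` by showing the assortment `S`, and continues as `k o` after the
answer `o`. -/
inductive Policy (n m : ℕ) : Type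
  | finish : Policy n m
  | mix (p : ℝ) (π σ : Policy n m) : Policy n m
  | display (a : Agent n m) (S : Finset (Agent n m))
      (k : Option (Agent n m) → Policy n m) : Policy n m

/-- Expected total number of matches when the policy is run from a given history. -/
def Policy.expectedMatches (φ : Choice n m) : Policy n m → History n m → ℝ
  | .finish, h => h.matches
  | .mix p π σ, h => p * π.expectedMatches φ h + (1 - p) * σ.expectedMatches φ h
  | .display a S k, h => ∑ o, φ a S o * (k o).expectedMatches φ (h.record a o)

/-- The possible answers to the assortment `S`. -/
def Possible (S : Finset (Agent n m)) (o : Option (Agent n m)) : Prop :=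
  ∀ b, o = some b → b ∈ S

/-- The three problems: customers first (customer-side one-sided adaptive), suppliers first
(supplier-side one-sided adaptive), and no restriction on the order (fully adaptive). -/
inductive Regime : Type
  | customersFirst
  | suppliersFirst
  | fullyAdaptive

/-- May `a` be processed next, given the history? In the one-sided regimes, the responding side
is processed only after the whole initiating side. -/
def Regime.Allows (r : Regime) (h : History n m) (a : Agent n m) : Prop :=
  match r with
  | .customersFirst => a.isRight → ∀ i, h (Sum.inl i) ≠ none
  | .suppliersFirst => a.isLeft → ∀ j, h (Sum.inr j) ≠ none
  | .fullyAdaptive => True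

/-- Can `a` be on the initiating side? -/
def Regime.Initiates (r : Regime) (a : Agent n m) : Prop :=
  match r with
  | .customersFirst => a.isLeft
  | .suppliersFirst => a.isRight
  | .fullyAdaptive => True

/-- The approximation factor claimed for each problem. -/
def Regime.factor (r : Regime) : ℝ :=
  match r with
  | .customersFirst => 1 / 2
  | .suppliersFirst => 1 / 2
  | .fullyAdaptive => 1 / 4

/-- A display rule says which assortments may be shown to an agent, given the history. -/
abbrev DisplayRule (n m : ℕ) := History n m → Agent n m → Finset (Agent n m) → Prop

/-- Two-way constrained setting: every assortment shown to `a` has at most `K a` elements. -/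
def twoWay (K : Agent n m → ℕ) : DisplayRule n m := fun _ a S => S.card ≤ K a

/-- One-way constrained setting: at most `K a` of the agents shown to `a` are not yet processed
(these are the agents towards whom `a` initiates), whereas the number of already processed agents
(to whom `a` responds) is unlimited. An agent whose choice model is not weakly substitutable is
moreover either initiating (nobody shown is processed) or responding, and in the latter
case it is shown only agents of its backlog, i.e. agents that have chosen it.

In the one-sided regimes, this says that an initiating agent is shown at most `K a`
agents, and that there is no cardinality constraint for the responding agents. -/
def oneWay (φ : Choice n m) (K : Agent n m → ℕ) : DisplayRule n m := fun h a S =>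
  (S.filter fun b => h b = none).card ≤ K a ∧
  (WeaklySubstitutable φ a ∨ (∀ b ∈ S, h b = none) ∨ (∀ b ∈ S, h b = some (some a)))

/-- Feasible policies: each agent is processed exactly once, in an order allowed by the regime,
with an assortment from the opposite side that the display rule allows. -/
def Policy.Feasible (D : DisplayRule n m) (r : Regime) : Policy n m → History n m → Prop
  | .finish, h => ∀ a, h a ≠ none
  | .mix p π σ, h => (0 ≤ p ∧ p ≤ 1) ∧ π.Feasible D r h ∧ σ.Feasible D r h
  | .display a S k, h =>
      h a = none ∧ r.Allows h a ∧ S ⊆ opposite a ∧ D h a S ∧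
      ∀ o, Possible S o → (k o).Feasible D r (h.record a o)

/-- `π` is a feasible policy whose expected number of matches is at least `c` times that of every
feasible policy, that is, at least `c` times the optimal value. -/
def IsApprox (φ : Choice n m) (D : DisplayRule n m) (r : Regime) (c : ℝ) (π : Policy n m) : Prop :=
  π.Feasible D r History.init ∧
  ∀ σ : Policy n m, σ.Feasible D r History.init →
    c * σ.expectedMatches φ History.init ≤ π.expectedMatches φ History.init

/-! ### Algorithms

Programs for a random access machine with real registers: a program is one fixed piece of text,
used for markets of all sizes. The memory consists of arrays (with two indices) of natural numbers
and of real numbers; the naturals serve as indices and counters and can only be added, subtracted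
and compared, while the reals admit the field operations and comparisons. Besides, a program can
flip a fair coin, process an agent, and, if available, consult the oracles. Every elementary
command, every evaluation of a test and every call counts as one step. -/

/-- Expressions for natural numbers (`sub` is truncated); `get x i j` reads an array cell. -/
inductive NExp : Type
  | lit (k : ℕ)
  | get (x : ℕ) (i j : NExp)
  | add (a b : NExp)
  | sub (a b : NExp)

/-- Expressions for real numbers (with `x / 0 = 0`). -/
inductive RExp : Type
  | zero
  | one
  | get (x : ℕ) (i j : NExp)
  | add (a b : RExp)
  | sub (a b : RExp)
  | mul (a b : RExp)
  | div (a b : RExp)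

/-- Tests. -/
inductive BExp : Type
  | nle (a b : NExp)
  | rle (a b : RExp)
  | not (a : BExp)
  | and (a b : BExp)

/-- Programs. An agent is addressed by its side (`0` for customers, `1` for suppliers) and its
number on that side. Row `r` of the array `x` of naturals represents the assortment of those
agents `b` of the opposite side for which the entry number `b` is nonzero. Answers are encoded by
`0` for the outside option and by the number plus one for an agent. -/
inductive Cmd : Type
  | skip
  | nset (x : ℕ) (i j : NExp) (e : NExp)
  | rset (x : ℕ) (i j : NExp) (e : RExp)
  | seq (c d : Cmd)
  | ite (t : BExp) (c d : Cmd)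
  | while (t : BExp) (c : Cmd)
  /-- flip a fair coin and store the outcome `0` or `1` in the cell `(i, j)` of the array `x` -/
  | coin (x : ℕ) (i j : NExp)
  /-- show agent `(side, idx)` the assortment in row `r` of `x`; store the answer in `y (i, j)` -/
  | display (side idx : NExp) (x : ℕ) (r : NExp) (y : ℕ) (i j : NExp)
  /-- query the probability that agent `(side, idx)` answers `o` to the assortment in row `r` of
  `x`; store it in the real cell `y (i, j)` -/
  | prob (side idx : NExp) (x : ℕ) (r o : NExp) (y : ℕ) (i j : NExp)
  /-- call the assortment optimization oracle of agent `(side, idx)` with the values in row `r`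
  of the real array `x`; store the assortment in row `i` of `y` -/
  | best (side idx : NExp) (x : ℕ) (r : NExp) (y : ℕ) (i : NExp)

/-- The memory. -/
structure Store where
  /-- the arrays of naturals -/
  nat : ℕ → ℕ → ℕ → ℕ
  /-- the arrays of reals -/
  real : ℕ → ℕ → ℕ → ℝ

/-- Write a natural number into a cell. -/
def Store.setNat (s : Store) (x i j v : ℕ) : Store :=
  { s with nat := fun x' i' j' => if x' = x ∧ i' = i ∧ j' = j then v else s.nat x' i' j' }

/-- Write a real number into a cell. -/
def Store.setReal (s : Store) (x i j : ℕ) (v : ℝ) : Store :=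
  { s with real := fun x' i' j' => if x' = x ∧ i' = i ∧ j' = j then v else s.real x' i' j' }

/-- Overwrite a row of naturals. -/
def Store.setRow (s : Store) (x i : ℕ) (v : ℕ → ℕ) : Store :=
  { s with nat := fun x' i' j' => if x' = x ∧ i' = i then v j' else s.nat x' i' j' }

/-- Value of an expression. -/
def NExp.eval (s : Store) : NExp → ℕ
  | .lit k => k
  | .get x i j => s.nat x (i.eval s) (j.eval s)
  | .add a b => a.eval s + b.eval s
  | .sub a b => a.eval s - b.eval s

/-- Value of an expression. -/
def RExp.eval (s : Store) : RExp → ℝ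
  | .zero => 0
  | .one => 1
  | .get x i j => s.real x (i.eval s) (j.eval s)
  | .add a b => a.eval s + b.eval s
  | .sub a b => a.eval s - b.eval s
  | .mul a b => a.eval s * b.eval s
  | .div a b => a.eval s / b.eval s

/-- Meaning of a test. -/
def BExp.Holds (s : Store) : BExp → Prop
  | .nle a b => a.eval s ≤ b.eval s
  | .rle a b => a.eval s ≤ b.eval s
  | .not a => ¬ a.Holds s
  | .and a b => a.Holds s ∧ b.Holds s

/-- The agent with a given side and number, if there is one. -/
def agentAt (n m side idx : ℕ) : Option (Agent n m) :=
  if side = 0 then (if hi : idx < n then some (Sum.inl ⟨idx, hi⟩) else none)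
  else if side = 1 then (if hj : idx < m then some (Sum.inr ⟨idx, hj⟩) else none)
  else none

/-- The number of an agent on its side. -/
def number (a : Agent n m) : ℕ := Sum.elim Fin.val Fin.val a

/-- The code of an answer. -/
def answerCode (o : Option (Agent n m)) : ℕ := o.elim 0 fun b => number b + 1

/-- The assortment for `a` represented by row `r` of the array `x`. -/
def readSet (s : Store) (a : Agent n m) (x r : ℕ) : Finset (Agent n m) :=
  (opposite a).filter fun b => s.nat x r (number b) ≠ 0

/-- What a program can query: choice probabilities, and solutions of single-agent assortment
optimization problems. -/
structure Oracles (n m : ℕ) where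
  /-- choice probabilities -/
  prob : Choice n m
  /-- an assortment for the given agent and the given values of the agents opposite to it -/
  best : Agent n m → (Agent n m → ℝ) → Finset (Agent n m)

/-- Oracles that give no information. -/
def noOracles (n m : ℕ) : Oracles n m := ⟨fun _ _ _ => 0, fun _ _ => ∅⟩

open Classical in
/-- One step of a command that involves neither a coin nor an agent, where `L` is the list of
commands to be executed afterwards. Addressing an agent that does not exist is an error. -/
def detStep (O : Oracles n m) (c : Cmd) (L : List Cmd) (s : Store) : Option (List Cmd × Store) :=
  match c with
  | .skip => some (L, s)
  | .nset x i j e => some (L, s.setNat x (i.eval s) (j.eval s) (e.eval s))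
  | .rset x i j e => some (L, s.setReal x (i.eval s) (j.eval s) (e.eval s))
  | .seq c d => some (c :: d :: L, s)
  | .ite t c d => some ((if t.Holds s then c else d) :: L, s)
  | .while t c => some (if t.Holds s then c :: .while t c :: L else L, s)
  | .coin _ _ _ => none
  | .display _ _ _ _ _ _ _ => none
  | .prob side idx x r o y i j =>
      match agentAt n m (side.eval s) (idx.eval s) with
      | none => none
      | some a =>
        if o.eval s = 0 then
          some (L, s.setReal y (i.eval s) (j.eval s) (O.prob a (readSet s a x (r.eval s)) none))
        else
          match agentAt n m (1 - side.eval s) (o.eval s - 1) with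
          | none => none
          | some b =>
            some (L, s.setReal y (i.eval s) (j.eval s)
              (O.prob a (readSet s a x (r.eval s)) (some b)))
  | .best side idx x r y i =>
      match agentAt n m (side.eval s) (idx.eval s) with
      | none => none
      | some a =>
        some (L, s.setRow y (i.eval s) fun t =>
          if ∃ b ∈ opposite a, b ∈ O.best a (fun b => s.real x (r.eval s) (number b)) ∧
            number b = t then 1 else 0)

/-- `Realizes O T L s π`: executing the commands of the list `L` from the memory `s` terminates
within `T` steps, whatever the coin flips and the answers of the agents, and the interaction with
the agents is the policy `π`. -/
inductive Realizes (O : Oracles n m) : ℕ → List Cmd → Store → Policy n m → Prop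
  | done (T : ℕ) (s : Store) : Realizes O T [] s .finish
  | det {T : ℕ} {c : Cmd} {L L' : List Cmd} {s s' : Store} {π : Policy n m}
      (hstep : detStep O c L s = some (L', s')) (hrest : Realizes O T L' s' π) :
      Realizes O (T + 1) (c :: L) s π
  | coin {T : ℕ} {x : ℕ} {i j : NExp} {L : List Cmd} {s : Store} {π σ : Policy n m}
      (hzero : Realizes O T L (s.setNat x (i.eval s) (j.eval s) 0) π)
      (hone : Realizes O T L (s.setNat x (i.eval s) (j.eval s) 1) σ) :
      Realizes O (T + 1) (.coin x i j :: L) s (.mix (1 / 2) π σ)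
  | display {T : ℕ} {side idx : NExp} {x : ℕ} {r : NExp} {y : ℕ} {i j : NExp} {L : List Cmd}
      {s : Store} {a : Agent n m} {k : Option (Agent n m) → Policy n m}
      (hagent : agentAt n m (side.eval s) (idx.eval s) = some a)
      (hrest : ∀ o, Possible (readSet s a x (r.eval s)) o →
        Realizes O T L (s.setNat y (i.eval s) (j.eval s) (answerCode o)) (k o)) :
      Realizes O (T + 1) (.display side idx x r y i j :: L) s
        (.display a (readSet s a x (r.eval s)) k)

/-- The initial memory. The array `0` of naturals holds `n` and `m` in its cells `(0, 0)` and
`(0, 1)`; the array `1` holds the bound of the agent `(side, i)` in its cell `(side, i)`; the real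
array number `side` holds in its cell `(i, j)` the weight that the agent `(side, i)` gives to agent
number `j` of the opposite side. All other cells are zero. -/
def input (K : Agent n m → ℕ) (u : Agent n m → Agent n m → ℝ) : Store where
  nat := fun x i j =>
    if x = 0 ∧ i = 0 ∧ j = 0 then n
    else if x = 0 ∧ i = 0 ∧ j = 1 then m
    else if x = 1 then (agentAt n m i j).elim 0 K
    else 0
  real := fun side i j =>
    match agentAt n m side i, agentAt n m (1 - side) j with
    | some a, some b => u a b
    | _, _ => 0

/-- The initial memory when the choice models are accessible only through oracles. -/
def inputWithoutWeights (K : Agent n m → ℕ) : Store := input K fun _ _ => 0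

/-- The oracle `best` solves, for every agent that may initiate and all nonnegative values `θ`, the
cardinality constrained single-agent assortment optimization problem. -/
def SolvesConstrainedAssortment (φ : Choice n m) (K : Agent n m → ℕ) (r : Regime)
    (best : Agent n m → (Agent n m → ℝ) → Finset (Agent n m)) : Prop :=
  ∀ a, r.Initiates a → ∀ θ : Agent n m → ℝ, (∀ b ∈ opposite a, 0 ≤ θ b) →
    best a θ ⊆ opposite a ∧ (best a θ).card ≤ K a ∧
    ∀ S ⊆ opposite a, S.card ≤ K a →
      ∑ b ∈ S, θ b * φ a S (some b) ≤ ∑ b ∈ best a θ, θ b * φ a (best a θ) (some b)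

end

end TwoSided

open TwoSided

namespace TwoSided

noncomputable section

variable {n m : ℕ}

/-! ### Running programs -/

/-! Credit every match to the agent that answers second. The expected number of matches then splits
into two rewards, one for each side that may have answered first (`Policy.expectedMatches_eq`); if
one side has to be processed before the other, one of them vanishes (`Policy.reward_eq_zero`). So it
suffices to fix an initiating side, to bound this reward for an arbitrary policy, in whatever order
it works, and to find a greedy policy that earns half of the bound.

The bound is weak duality. Let `F b B` be a monotone submodular estimate of what the backlog `B` is
worth to the responder `b` (`Valuation`). Choose reference sets `A b`, prices `w a b ≥ 0` that are
at least the marginal value of `a` over `A b`, and numbers `V a` that are at least the value of any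
assortment of at most `K a` elements for `a` at these prices. Then the reward is at most the sum of
all `V a` and all `F b (A b)` (`Policy.reward_le`): an initiator pays with `V a` for the prices that
it deposits, and the deposits of a responder together with `F b (A b)` pay for its match, by
submodularity.

The greedy policy shows each initiator `a` an optimal assortment for the current marginal values.
Take the realized final backlogs as `A`, these marginal values as `w a`, and the optimum as `V a`.
Marginal values only decrease later, so this is dual feasible on every path (`Dominates.mono`). The
expected sum of the `V a` is the expected growth of the total backlog value, and the responders turn
that total into at least as many expected matches; hence the bound is at most twice what greedy
earns (`Subroutines.initiate_phase`). In the fully adaptive case, tossing a coin for the initiating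
side costs another factor two.

In the one-way setting `F` is the demand function. In the two-way setting it is the best choice
probability from the backlog within the bound, which is the concave function `x / (1 + x)` of the
largest weight of at most `K b` elements, a weighted uniform matroid rank (`valuation_twoWay`).
There the assortment problems are solved by a parametric search over the finitely many multipliers
at which two items swap order (`exists_crossing_optimal`). -/

theorem Realizes.mono {O : Oracles n m} {T : ℕ} {L : List Cmd} {s : Store} {π : Policy n m}
    (h : Realizes O T L s π) : ∀ {T' : ℕ}, T ≤ T' → Realizes O T' L s π := by
  induction h with
  | done T s => intro T' _; exact .done T' s
  | det hstep _ ih =>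
    intro T' hT
    obtain ⟨T'', rfl⟩ : ∃ T'', T' = T'' + 1 := ⟨T' - 1, by omega⟩
    exact .det hstep (ih (by omega))
  | coin _ _ ih0 ih1 =>
    intro T' hT
    obtain ⟨T'', rfl⟩ : ∃ T'', T' = T'' + 1 := ⟨T' - 1, by omega⟩
    exact .coin (ih0 (by omega)) (ih1 (by omega))
  | display hagent _ ih =>
    intro T' hT
    obtain ⟨T'', rfl⟩ : ∃ T'', T' = T'' + 1 := ⟨T' - 1, by omega⟩
    exact .display hagent fun o ho => ih o ho (by omega)

/-- From the memory `s`, the command `c` ends within `t` steps with the memory `s'`, without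
involving coins or agents. -/
def Det (O : Oracles n m) (c : Cmd) (t : ℕ) (s s' : Store) : Prop :=
  ∀ T L π, Realizes O T L s' π → Realizes O (T + t) (c :: L) s π

namespace Det
variable {O : Oracles n m} {s s₁ s₂ : Store} {c d : Cmd} {t t₁ t₂ : ℕ}

theorem mono (h : Det O c t₁ s s₁) (ht : t₁ ≤ t₂) : Det O c t₂ s s₁ :=
  fun T L π hr => (h T L π hr).mono (by omega)

theorem of_step (h : ∀ L, detStep O c L s = some (L, s₁)) : Det O c 1 s s₁ :=
  fun _ L _ hr => .det (h L) hr

theorem skip : Det O .skip 1 s s := of_step fun _ => rfl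

theorem nset (x : ℕ) (i j e : NExp) :
    Det O (.nset x i j e) 1 s (s.setNat x (i.eval s) (j.eval s) (e.eval s)) := of_step fun _ => rfl

theorem rset (x : ℕ) (i j : NExp) (e : RExp) :
    Det O (.rset x i j e) 1 s (s.setReal x (i.eval s) (j.eval s) (e.eval s)) := of_step fun _ => rfl

theorem seq (h₁ : Det O c t₁ s s₁) (h₂ : Det O d t₂ s₁ s₂) :
    Det O (.seq c d) (t₁ + t₂ + 1) s s₂ := fun T L π hr =>
  (Realizes.det (T := T + t₂ + t₁) rfl (h₁ _ _ _ (h₂ _ _ _ hr))).mono (by omega)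

theorem ite_true {b : BExp} (hb : b.Holds s) (h : Det O c t s s₁) :
    Det O (.ite b c d) (t + 1) s s₁ := fun T L π hr =>
  .det (T := T + t) (by simp [detStep, hb]) (h _ _ _ hr)

theorem ite_false {b : BExp} (hb : ¬ b.Holds s) (h : Det O d t s s₁) :
    Det O (.ite b c d) (t + 1) s s₁ := fun T L π hr =>
  .det (T := T + t) (by simp [detStep, hb]) (h _ _ _ hr)

theorem while_true {b : BExp} (hb : b.Holds s) (h : Det O c t₁ s s₁)
    (h' : Det O (.while b c) t₂ s₁ s₂) : Det O (.while b c) (t₁ + t₂ + 1) s s₂ :=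
  fun T L π hr => (Realizes.det (T := T + t₂ + t₁) (by simp [detStep, hb])
    (h _ _ _ (h' _ _ _ hr))).mono (by omega)

theorem while_false {b : BExp} (hb : ¬ b.Holds s) : Det O (.while b c) 1 s s :=
  of_step fun L => by simp [detStep, hb]

end Det

/-- The scalar variable stored in cell `(0, 0)` of the array `x` of naturals. -/
def nvar (x : ℕ) : NExp := .get x (.lit 0) (.lit 0)

/-- The scalar variable stored in cell `(0, 0)` of the array `x` of reals. -/
def rvar (x : ℕ) : RExp := .get x (.lit 0) (.lit 0)

/-- The body of a counting loop. -/
def forBody (k : ℕ) (c : Cmd) : Cmd :=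
  .seq c (.nset k (.lit 0) (.lit 0) (.add (nvar k) (.lit 1)))

/-- Run `c` while the variable `k` is less than `N`, incrementing `k` each time. -/
def whileLoop (k : ℕ) (N : NExp) (c : Cmd) : Cmd :=
  .while (.not (.nle N (nvar k))) (forBody k c)

/-- Run `c` with the variable `k` ranging over the numbers less than `N`. -/
def forLoop (k : ℕ) (N : NExp) (c : Cmd) : Cmd :=
  .seq (.nset k (.lit 0) (.lit 0) (.lit 0)) (whileLoop k N c)

/-! ### Evaluation of expressions and effect of memory updates -/

section eval
variable (s : Store)
@[simp] theorem NExp.eval_lit (k : ℕ) : (NExp.lit k).eval s = k := rfl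
@[simp] theorem NExp.eval_get (x : ℕ) (i j : NExp) :
    (NExp.get x i j).eval s = s.nat x (i.eval s) (j.eval s) := rfl
@[simp] theorem NExp.eval_add (a b : NExp) : (NExp.add a b).eval s = a.eval s + b.eval s := rfl
@[simp] theorem NExp.eval_sub (a b : NExp) : (NExp.sub a b).eval s = a.eval s - b.eval s := rfl
@[simp] theorem NExp.eval_nvar (x : ℕ) : (nvar x).eval s = s.nat x 0 0 := rfl
@[simp] theorem RExp.eval_zero : RExp.zero.eval s = 0 := rfl
@[simp] theorem RExp.eval_one : RExp.one.eval s = 1 := rfl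
@[simp] theorem RExp.eval_get (x : ℕ) (i j : NExp) :
    (RExp.get x i j).eval s = s.real x (i.eval s) (j.eval s) := rfl
@[simp] theorem RExp.eval_rvar (x : ℕ) : (rvar x).eval s = s.real x 0 0 := rfl
@[simp] theorem RExp.eval_add (a b : RExp) : (RExp.add a b).eval s = a.eval s + b.eval s := rfl
@[simp] theorem RExp.eval_sub (a b : RExp) : (RExp.sub a b).eval s = a.eval s - b.eval s := rfl
@[simp] theorem RExp.eval_mul (a b : RExp) : (RExp.mul a b).eval s = a.eval s * b.eval s := rfl
@[simp] theorem RExp.eval_div (a b : RExp) : (RExp.div a b).eval s = a.eval s / b.eval s := rfl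
@[simp] theorem BExp.holds_nle (a b : NExp) :
    (BExp.nle a b).Holds s ↔ a.eval s ≤ b.eval s := Iff.rfl
@[simp] theorem BExp.holds_rle (a b : RExp) :
    (BExp.rle a b).Holds s ↔ a.eval s ≤ b.eval s := Iff.rfl
@[simp] theorem BExp.holds_not (a : BExp) : (BExp.not a).Holds s ↔ ¬ a.Holds s := Iff.rfl
@[simp] theorem BExp.holds_and (a b : BExp) :
    (BExp.and a b).Holds s ↔ a.Holds s ∧ b.Holds s := Iff.rfl

@[simp] theorem Store.real_setNat (x i j v : ℕ) : (s.setNat x i j v).real = s.real := rfl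
@[simp] theorem Store.nat_setReal (x i j : ℕ) (v : ℝ) : (s.setReal x i j v).nat = s.nat := rfl
theorem Store.nat_setNat (x i j v x' i' j' : ℕ) : (s.setNat x i j v).nat x' i' j' =
    if x' = x ∧ i' = i ∧ j' = j then v else s.nat x' i' j' := rfl
theorem Store.real_setReal (x i j : ℕ) (v : ℝ) (x' i' j' : ℕ) :
    (s.setReal x i j v).real x' i' j' =
    if x' = x ∧ i' = i ∧ j' = j then v else s.real x' i' j' := rfl
@[simp] theorem Store.nat_setNat_self (x i j v : ℕ) : (s.setNat x i j v).nat x i j = v := by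
  simp [Store.nat_setNat]
@[simp] theorem Store.real_setReal_self (x i j : ℕ) (v : ℝ) :
    (s.setReal x i j v).real x i j = v := by
  simp [Store.real_setReal]
theorem Store.nat_setNat_ne {x x' : ℕ} (h : x' ≠ x) (i j v : ℕ) :
    (s.setNat x i j v).nat x' = s.nat x' := by
  funext i' j'; simp [Store.nat_setNat, h]
theorem Store.real_setReal_ne {x x' : ℕ} (h : x' ≠ x) (i j : ℕ) (v : ℝ) :
    (s.setReal x i j v).real x' = s.real x' := by
  funext i' j'; simp [Store.real_setReal, h]
theorem Store.nat_setRow_ne {x x' : ℕ} (h : x' ≠ x) (i : ℕ) (v : ℕ → ℕ) :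
    (s.setRow x i v).nat x' = s.nat x' := by
  funext i' j'; simp [Store.setRow, h]
@[simp] theorem Store.nat_setRow_self (x i : ℕ) (v : ℕ → ℕ) :
    (s.setRow x i v).nat x i = v := by
  funext j'; simp [Store.setRow]
end eval

/-- The arrays with numbers less than `p` are the same in `s` and in `s'`. -/
def Keep (p : ℕ) (s s' : Store) : Prop :=
  (∀ x < p, s'.nat x = s.nat x) ∧ ∀ x < p, s'.real x = s.real x

namespace Keep
variable {p q : ℕ} {s s₁ s₂ : Store}
theorem refl (p : ℕ) (s : Store) : Keep p s s := ⟨fun _ _ => rfl, fun _ _ => rfl⟩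
theorem trans (h₁ : Keep p s s₁) (h₂ : Keep p s₁ s₂) : Keep p s s₂ :=
  ⟨fun x hx => (h₂.1 x hx).trans (h₁.1 x hx), fun x hx => (h₂.2 x hx).trans (h₁.2 x hx)⟩
theorem anti (h : Keep p s s₁) (hq : q ≤ p) : Keep q s s₁ :=
  ⟨fun x hx => h.1 x (by omega), fun x hx => h.2 x (by omega)⟩
theorem setNat (h : Keep p s s₁) {x : ℕ} (hx : p ≤ x) (i j v : ℕ) :
    Keep p s (s₁.setNat x i j v) :=
  ⟨fun x' hx' => by rw [Store.nat_setNat_ne _ (by omega), h.1 x' hx'], h.2⟩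
theorem setReal (h : Keep p s s₁) {x : ℕ} (hx : p ≤ x) (i j : ℕ) (v : ℝ) :
    Keep p s (s₁.setReal x i j v) :=
  ⟨h.1, fun x' hx' => by rw [Store.real_setReal_ne _ (by omega), h.2 x' hx']⟩
theorem setRow (h : Keep p s s₁) {x : ℕ} (hx : p ≤ x) (i : ℕ) (v : ℕ → ℕ) :
    Keep p s (s₁.setRow x i v) :=
  ⟨fun x' hx' => by rw [Store.nat_setRow_ne _ (by omega), h.1 x' hx'], h.2⟩
end Keep

/-- Rule for counting loops with an invariant that does not mention the counter. -/
theorem Det.forLoop {O : Oracles n m} {k : ℕ} {N : NExp} {c : Cmd} {t M : ℕ}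
    (I : ℕ → Store → Prop) (hN : ∀ i s, I i s → N.eval s = M)
    (hk : ∀ i s v, I i s → I i (s.setNat k 0 0 v))
    (hc : ∀ i < M, ∀ s, I i s → s.nat k 0 0 = i →
      ∃ s', Det O c t s s' ∧ s'.nat k 0 0 = i ∧ I (i + 1) s')
    {s : Store} (h0 : I 0 s) :
    ∃ s', Det O (forLoop k N c) (M * (t + 3) + 3) s s' ∧ I M s' := by
  -- Induction on the number `d` of iterations left. Besides the body, an iteration pays for the
  -- test, the sequencing and the increment, hence `t + 3`.
  have key : ∀ d i s, i + d = M → I i s → s.nat k 0 0 = i →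
      ∃ s', Det O (whileLoop k N c) (d * (t + 3) + 1) s s' ∧ I M s' := by
    intro d
    induction d with
    | zero =>
      intro i s hi hI hs
      obtain rfl : i = M := by omega
      exact ⟨s, (Det.while_false (by simp [hs, hN _ _ hI])).mono (by omega), hI⟩
    | succ d ih =>
      intro i s hi hI hs
      obtain ⟨s₁, h₁, hk₁, hI₁⟩ := hc i (by omega) s hI hs
      obtain ⟨s₂, h₂, hI₂⟩ := ih (i + 1) (s₁.setNat k 0 0 (i + 1)) (by omega)
        (hk _ _ _ hI₁) (by simp)
      have h₂' : Det O (whileLoop k N c) (d * (t + 3) + 1)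
          (s₁.setNat k 0 0 (s₁.nat k 0 0 + 1)) s₂ := by rwa [hk₁]
      exact ⟨s₂, (Det.while_true (by simp [hs, hN _ _ hI]; omega)
        (h₁.seq (Det.nset _ _ _ _)) h₂').mono (by ring_nf; omega), hI₂⟩
  obtain ⟨s', h, hI⟩ := key M 0 (s.setNat k 0 0 0) (by omega) (hk _ _ _ h0) (by simp)
  exact ⟨s', ((Det.nset _ _ _ _).seq h).mono (by omega), hI⟩

/-! ### Addressing agents -/

/-- The side of an agent: `0` for customers, `1` for suppliers. -/
def sideOf (a : Agent n m) : ℕ := Sum.elim (fun _ => 0) (fun _ => 1) a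

/-- The number of agents on a side. -/
def sideCard (n m side : ℕ) : ℕ := if side = 0 then n else m

theorem sideOf_le (a : Agent n m) : sideOf a ≤ 1 := by cases a <;> simp [sideOf]

theorem sideCard_le (n m side : ℕ) : sideCard n m side ≤ n + m := by
  unfold sideCard; split_ifs <;> omega

theorem mem_opposite {a b : Agent n m} : b ∈ opposite a ↔ sideOf b = 1 - sideOf a := by
  cases a <;> cases b <;> simp [opposite, sideOf]

theorem mem_opposite_comm {a b : Agent n m} : b ∈ opposite a ↔ a ∈ opposite b := by
  cases a <;> cases b <;> simp [opposite]

theorem number_lt (a : Agent n m) : number a < sideCard n m (sideOf a) := by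
  cases a <;> simp [number, sideCard, sideOf]

theorem agentAt_number (a : Agent n m) : agentAt n m (sideOf a) (number a) = some a := by
  cases a <;> simp [agentAt, number, sideOf]

theorem number_inj {a b : Agent n m} (hs : sideOf a = sideOf b) (h : number a = number b) :
    a = b := by
  have := agentAt_number a
  rw [hs, h, agentAt_number b] at this
  exact (Option.some.inj this).symm

theorem exists_agent {side i : ℕ} (hs : side ≤ 1) (hi : i < sideCard n m side) :
    ∃ a : Agent n m, sideOf a = side ∧ number a = i := by
  obtain rfl | rfl : side = 0 ∨ side = 1 := by omega
  · exact ⟨.inl ⟨i, by simpa [sideCard] using hi⟩, rfl, rfl⟩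
  · exact ⟨.inr ⟨i, by simpa [sideCard] using hi⟩, rfl, rfl⟩

/-- A code forgets the side of the chosen agent, so it is faithful only for answers on the side
opposite to `a`. -/
theorem answerCode_eq_iff {a b : Agent n m} (hb : b ∈ opposite a) {o : Option (Agent n m)}
    (ho : ∀ c, o = some c → c ∈ opposite a) : answerCode o = number b + 1 ↔ o = some b := by
  cases o with
  | none => simp [answerCode]
  | some c =>
    have hc := ho c rfl
    rw [mem_opposite] at hb hc
    simp only [answerCode, Option.elim_some, Nat.add_right_cancel_iff, Option.some.injEq]
    exact ⟨fun h => number_inj (by rw [hb, hc]) h, fun h => by rw [h]⟩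

theorem input_count (K : Agent n m → ℕ) (u : Agent n m → Agent n m → ℝ) {side : ℕ}
    (hs : side ≤ 1) : (input K u).nat 0 0 side = sideCard n m side := by
  obtain rfl | rfl : side = 0 ∨ side = 1 := by omega
  all_goals simp [input, sideCard]

theorem input_bound (K : Agent n m → ℕ) (u : Agent n m → Agent n m → ℝ) (a : Agent n m) :
    (input K u).nat 1 (sideOf a) (number a) = K a := by
  simp [input, agentAt_number]

/-! ### Choice models -/

section choice
variable {φ : Choice n m} {a : Agent n m} {S : Finset (Agent n m)}

theorem IsChoiceModel.nonneg (hφ : IsChoiceModel φ) (hS : S ⊆ opposite a) (o) : 0 ≤ φ a S o :=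
  (hφ a S hS).1 o

theorem IsChoiceModel.sum_eq_one (hφ : IsChoiceModel φ) (hS : S ⊆ opposite a) :
    ∑ o, φ a S o = 1 := (hφ a S hS).2.1

theorem IsChoiceModel.eq_zero (hφ : IsChoiceModel φ) (hS : S ⊆ opposite a)
    {o : Option (Agent n m)} (ho : ¬ Possible S o) : φ a S o = 0 := by
  simp only [Possible, not_forall] at ho
  obtain ⟨b, rfl, hb⟩ := ho
  exact (hφ a S hS).2.2 b hb

/-- Impossible answers have probability zero. This matters because neither feasibility nor the
execution of a program says anything about the continuation after such an answer. -/
theorem IsChoiceModel.sum_le_sum (hφ : IsChoiceModel φ) (hS : S ⊆ opposite a)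
    {f g : Option (Agent n m) → ℝ} (h : ∀ o, Possible S o → f o ≤ g o) :
    ∑ o, φ a S o * f o ≤ ∑ o, φ a S o * g o := by
  refine Finset.sum_le_sum fun o _ => ?_
  by_cases ho : Possible S o
  · exact mul_le_mul_of_nonneg_left (h o ho) (hφ.nonneg hS o)
  · simp [hφ.eq_zero hS ho]

theorem IsChoiceModel.sum_congr (hφ : IsChoiceModel φ) (hS : S ⊆ opposite a)
    {f g : Option (Agent n m) → ℝ} (h : ∀ o, Possible S o → f o = g o) :
    ∑ o, φ a S o * f o = ∑ o, φ a S o * g o :=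
  le_antisymm (hφ.sum_le_sum hS fun o ho => (h o ho).le)
    (hφ.sum_le_sum hS fun o ho => (h o ho).ge)

theorem IsChoiceModel.sum_const_add (hφ : IsChoiceModel φ) (hS : S ⊆ opposite a) (x : ℝ)
    (g : Option (Agent n m) → ℝ) :
    ∑ o, φ a S o * (x + g o) = x + ∑ o, φ a S o * g o := by
  simp_rw [mul_add, Finset.sum_add_distrib]
  rw [← Finset.sum_mul, hφ.sum_eq_one hS, one_mul]

theorem IsChoiceModel.sum_elim (hφ : IsChoiceModel φ) (hS : S ⊆ opposite a)
    (g : Agent n m → ℝ) :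
    ∑ o : Option (Agent n m), φ a S o * o.elim 0 g = ∑ c ∈ S, g c * φ a S (some c) := by
  rw [Fintype.sum_option]
  simp only [Option.elim_none, mul_zero, Option.elim_some, zero_add]
  symm
  refine (Finset.sum_subset (Finset.subset_univ S) fun c _ hc => ?_).trans
    (Finset.sum_congr rfl fun c _ => mul_comm _ _)
  rw [(hφ a S hS).2.2 c hc, mul_zero]

theorem IsChoiceModel.demand_eq (hφ : IsChoiceModel φ) (hS : S ⊆ opposite a) :
    demand φ a S = 1 - φ a S none := by
  have h := hφ.sum_eq_one hS
  have h' := hφ.sum_elim hS fun _ => 1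
  rw [Fintype.sum_option] at h h'
  simp only [Option.elim_none, mul_zero, Option.elim_some, zero_add, mul_one, one_mul] at h'
  rw [demand, ← h', ← h]; ring

end choice

/-! ### Rewards of policies -/

/-- The agents that have chosen `b`. -/
def backlog (h : History n m) (b : Agent n m) : Finset (Agent n m) :=
  (opposite b).filter fun a => h a = some (some b)

theorem mem_backlog {h : History n m} {a b : Agent n m} :
    a ∈ backlog h b ↔ a ∈ opposite b ∧ h a = some (some b) := by simp [backlog]

theorem backlog_subset (h : History n m) (b : Agent n m) : backlog h b ⊆ opposite b :=
  Finset.filter_subset _ _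

theorem History.record_self (h : History n m) (a : Agent n m) (o) : h.record a o a = some o := by
  simp [History.record]

theorem History.record_ne (h : History n m) {a b : Agent n m} (hb : b ≠ a) (o) :
    h.record a o b = h b := by
  simp [History.record, hb]

/-- The number of matches that arise when `a` answers `o`. -/
def gain (h : History n m) (a : Agent n m) (o : Option (Agent n m)) : ℝ :=
  o.elim 0 fun c => if h c = some (some a) then 1 else 0

/-- An unprocessed agent is in no match so far, and afterwards it can be matched only with the agent
that it chose. -/
theorem matches_record {h : History n m} {a : Agent n m} (ha : h a = none)
    {o : Option (Agent n m)} (ho : ∀ c, o = some c → c ∈ opposite a) :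
    ((h.record a o).matches : ℝ) = h.matches + gain h a o := by
  classical
  have key : (h.record a o).matches = h.matches +
      o.elim 0 (fun c => if h c = some (some a) then 1 else 0) := by
    cases o with
    | none =>
      simp only [Option.elim_none, add_zero, History.matches]
      congr 1
      ext p
      rcases a with i | j
      · by_cases h1 : p.1 = i <;> simp [History.record, Function.update_apply, h1, ha]
      · by_cases h1 : p.2 = j <;> simp [History.record, Function.update_apply, h1, ha]
    | some c =>
      have hc := ho c rfl
      simp only [Option.elim_some]
      rcases a with i | j <;> rcases c with i' | j'
      · simp [opposite] at hc
      · by_cases hm : h (.inr j') = some (some (.inl i))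
        · rw [if_pos hm, History.matches, History.matches,
            ← Finset.card_insert_of_notMem (a := (i, j')) (by simp [ha])]
          congr 1
          ext ⟨p, q⟩
          by_cases h1 : p = i
          · subst h1
            simp [History.record, Function.update_apply, ha]
            constructor
            · rintro ⟨rfl, _⟩; rfl
            · rintro rfl; exact ⟨rfl, hm⟩
          · simp [History.record, Function.update_apply, h1]
        · rw [if_neg hm, add_zero, History.matches, History.matches]
          congr 1
          ext ⟨p, q⟩
          by_cases h1 : p = i
          · subst h1
            simp [History.record, Function.update_apply, ha]
            rintro rfl; exact hm
          · simp [History.record, Function.update_apply, h1]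
      · by_cases hm : h (.inl i') = some (some (.inr j))
        · rw [if_pos hm, History.matches, History.matches,
            ← Finset.card_insert_of_notMem (a := (i', j)) (by simp [ha])]
          congr 1
          ext ⟨p, q⟩
          by_cases h1 : q = j
          · subst h1
            simp [History.record, Function.update_apply, ha]
            constructor
            · rintro ⟨_, rfl⟩; rfl
            · rintro rfl; exact ⟨hm, rfl⟩
          · simp [History.record, Function.update_apply, h1]
        · rw [if_neg hm, add_zero, History.matches, History.matches]
          congr 1
          ext ⟨p, q⟩
          by_cases h1 : q = j
          · subst h1
            simp [History.record, Function.update_apply, ha]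
            rintro h2 rfl; exact hm h2
          · simp [History.record, Function.update_apply, h1]
      · simp [opposite] at hc
  rw [key]
  cases o <;> simp [gain]

/-- The expected number of future matches that are completed by an agent not on the given side. -/
def Policy.reward (φ : Choice n m) (side : ℕ) : Policy n m → History n m → ℝ
  | .finish, _ => 0
  | .mix p π σ, h => p * π.reward φ side h + (1 - p) * σ.reward φ side h
  | .display a S k, h =>
    ∑ o, φ a S o * ((if sideOf a = side then 0 else gain h a o) + (k o).reward φ side (h.record a o))

theorem Possible.mem_opposite {S : Finset (Agent n m)} {a : Agent n m} (hS : S ⊆ opposite a)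
    {o : Option (Agent n m)} (ho : Possible S o) (c) (hc : o = some c) : c ∈ opposite a :=
  hS (ho c hc)

/-- Each new match is completed by the agent answering now, whose gain is counted in exactly one of
the two rewards. -/
theorem Policy.expectedMatches_eq {φ : Choice n m} (hφ : IsChoiceModel φ) {D : DisplayRule n m}
    {r : Regime} (π : Policy n m) : ∀ h : History n m, π.Feasible D r h →
    π.expectedMatches φ h = h.matches + (π.reward φ 0 h + π.reward φ 1 h) := by
  induction π with
  | finish => intro h _; simp [expectedMatches, reward]
  | mix p π σ ih₁ ih₂ =>
    intro h hf
    simp only [expectedMatches, reward, ih₁ h hf.2.1, ih₂ h hf.2.2]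
    ring
  | display a S k ih =>
    rintro h ⟨ha, _, hS, _, hk⟩
    simp only [expectedMatches, reward]
    simp_rw [← Finset.sum_add_distrib, ← mul_add]
    rw [← hφ.sum_const_add hS]
    refine hφ.sum_congr hS fun o ho => ?_
    rw [ih o _ (hk o ho), matches_record ha (ho.mem_opposite hS)]
    have : sideOf a = 0 ∨ sideOf a = 1 := by have := sideOf_le a; omega
    rcases this with h' | h' <;> simp [h'] <;> ring

/-- Every agent on the initiating side is processed before the agents of the other side. -/
def Regime.StartsWith (r : Regime) (side : ℕ) : Prop :=
  ∀ {n m : ℕ} (h : History n m) (a : Agent n m), r.Allows h a ↔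
    (sideOf a ≠ side → ∀ b : Agent n m, sideOf b = side → h b ≠ none)

theorem Regime.startsWith_customersFirst : Regime.customersFirst.StartsWith 0 := by
  intro n m h a
  cases a <;> simp [Regime.Allows, sideOf]

theorem Regime.startsWith_suppliersFirst : Regime.suppliersFirst.StartsWith 1 := by
  intro n m h a
  cases a <;> simp [Regime.Allows, sideOf]

/-- As long as an initiator is unprocessed no responder has answered, so an initiator never
completes a match. The last hypothesis is this invariant. -/
theorem Policy.reward_eq_zero {φ : Choice n m} (hφ : IsChoiceModel φ) {D : DisplayRule n m}
    {r : Regime} {side : ℕ} (hs : side ≤ 1) (hr : r.StartsWith side) (π : Policy n m) :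
    ∀ h : History n m, π.Feasible D r h →
      (∀ a, sideOf a = side → h a = none → ∀ b, sideOf b ≠ side → h b = none) →
      π.reward φ (1 - side) h = 0 := by
  induction π with
  | finish => intro h _ _; rfl
  | mix p π σ ih₁ ih₂ =>
    intro h hf hh
    simp [reward, ih₁ h hf.2.1 hh, ih₂ h hf.2.2 hh]
  | display a S k ih =>
    rintro h ⟨ha, hal, hS, _, hk⟩ hh
    rw [reward, hφ.sum_congr hS (g := fun _ => 0)]
    · simp
    intro o ho
    rw [ih o _ (hk o ho), add_zero]
    · split_ifs with h1
      · rfl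
      · have h2 : sideOf a = side := by have := sideOf_le a; omega
        cases o with
        | none => rfl
        | some c =>
          have hc := hS (ho c rfl)
          rw [TwoSided.mem_opposite] at hc
          simp [gain, hh a h2 ha c (by omega)]
    · intro b hb hb0 c hc
      have hba : b ≠ a := by rintro rfl; simp [History.record_self] at hb0
      rw [History.record_ne _ hba] at hb0
      have hca : c ≠ a := by
        rintro rfl
        exact (hr h c).1 hal hc b hb hb0
      rw [History.record_ne _ hca]
      exact hh b hb hb0 c hc

/-! ### An upper bound for the rewards of feasible policies -/

/-- The set functions `F b` are suitable estimates of the value of a backlog of `b`. -/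
structure Valuation (φ : Choice n m) (K : Agent n m → ℕ) (D : DisplayRule n m)
    (F : Agent n m → Finset (Agent n m) → ℝ) : Prop where
  empty : ∀ b, 0 ≤ F b ∅
  mono : ∀ b A B, A ⊆ B → B ⊆ opposite b → F b A ≤ F b B
  submod : ∀ b A B, A ⊆ B → B ⊆ opposite b → ∀ e ∈ opposite b,
    F b (insert e B) - F b B ≤ F b (insert e A) - F b A
  respond : ∀ h b S, h b = none → S ⊆ opposite b → D h b S →
    ∑ c ∈ S, (if h c = some (some b) then 1 else 0) * φ b S (some c) ≤ F b (backlog h b)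
  initiate : ∀ h a S, S ⊆ opposite a → D h a S → ∀ θ : Agent n m → ℝ,
    (∀ c ∈ opposite a, 0 ≤ θ c) → ∃ S' ⊆ opposite a, S'.card ≤ K a ∧
      ∑ c ∈ S, (if h c = none then θ c else 0) * φ a S (some c) ≤
        ∑ c ∈ S', θ c * φ a S' (some c)

/-- `V` bounds what `a` contributes if being chosen by `a` is worth `w c` for `c`, and these values
are at least the marginal values of `a` with respect to the backlogs `A c`. -/
def Dominates (φ : Choice n m) (K : Agent n m → ℕ) (F : Agent n m → Finset (Agent n m) → ℝ)
    (A : Agent n m → Finset (Agent n m)) (a : Agent n m) (w : Agent n m → ℝ) (V : ℝ) : Prop :=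
  (∀ c ∈ opposite a, 0 ≤ w c ∧ F c (insert a (A c)) - F c (A c) ≤ w c) ∧
  ∀ S ⊆ opposite a, S.card ≤ K a → ∑ c ∈ S, w c * φ a S (some c) ≤ V

/-! ### The potential function and weak duality -/

section
variable {φ : Choice n m} {K : Agent n m → ℕ} {D : DisplayRule n m}
  {F : Agent n m → Finset (Agent n m) → ℝ}

/-- Adding the elements of `B` one at a time, each increment is at most the one over `A`, by
submodularity. -/
theorem Valuation.union_le (hF : Valuation φ K D F) {b : Agent n m}
    {A : Finset (Agent n m)} (hA : A ⊆ opposite b) {w : Agent n m → ℝ} (B : Finset (Agent n m)) :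
    B ⊆ opposite b → (∀ a ∈ B, F b (insert a A) - F b A ≤ w a) →
    F b (A ∪ B) ≤ F b A + ∑ a ∈ B, w a := by
  classical
  induction B using Finset.induction_on with
  | empty => simp
  | insert a B ha ih =>
    intro hB hw
    rw [Finset.insert_subset_iff] at hB
    have h1 := ih hB.2 fun a ha => hw a (Finset.mem_insert_of_mem ha)
    have h2 := hF.submod b A (A ∪ B) Finset.subset_union_left
      (Finset.union_subset hA hB.2) a hB.1
    have h3 := hw a (Finset.mem_insert_self _ _)
    rw [Finset.sum_insert ha, Finset.union_insert]
    linarith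

/-- Contribution of the agent `x` to the potential function. -/
def potTerm (side : ℕ) (F : Agent n m → Finset (Agent n m) → ℝ)
    (A : Agent n m → Finset (Agent n m)) (w : Agent n m → Agent n m → ℝ) (V : Agent n m → ℝ)
    (h : History n m) (x : Agent n m) : ℝ :=
  if h x = none then
    if sideOf x = side then V x else F x (A x) + ∑ a ∈ backlog h x, w a x
  else 0

theorem backlog_record {h : History n m} {a : Agent n m} (ha : h a = none)
    (o : Option (Agent n m)) {b : Agent n m} (hab : a ∈ opposite b) :
    backlog (h.record a o) b = if o = some b then insert a (backlog h b) else backlog h b := by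
  ext c
  by_cases hc : c = a
  · subst hc
    split_ifs with h1 <;> simp [mem_backlog, History.record_self, hab, h1, ha]
  · split_ifs with h1 <;> simp [mem_backlog, History.record_ne _ hc, hc]

theorem backlog_record_of_notMem {h : History n m} {a b : Agent n m}
    (o : Option (Agent n m)) (hab : a ∉ opposite b) :
    backlog (h.record a o) b = backlog h b := by
  ext c
  by_cases hc : c = a
  · subst hc
    simp [mem_backlog, hab]
  · simp [mem_backlog, History.record_ne _ hc]

theorem potTerm_record {side : ℕ} (hs : side ≤ 1) {A : Agent n m → Finset (Agent n m)}
    {w : Agent n m → Agent n m → ℝ} {V : Agent n m → ℝ} {h : History n m} {a : Agent n m}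
    (ha : h a = none) {o : Option (Agent n m)} (ho : ∀ c, o = some c → c ∈ opposite a)
    (x : Agent n m) (hx : x ≠ a) :
    potTerm side F A w V (h.record a o) x = potTerm side F A w V h x +
      if sideOf a = side ∧ o = some x ∧ h x = none then w a x else 0 := by
  unfold potTerm
  rw [History.record_ne _ hx]
  have hax : a ∈ opposite x ↔ sideOf a = 1 - sideOf x := mem_opposite
  have hsa := sideOf_le a
  have hsx := sideOf_le x
  by_cases h1 : h x = none
  · by_cases h2 : sideOf x = side
    · have : ¬ (sideOf a = side ∧ o = some x) := by
        rintro ⟨h3, h4⟩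
        have := ho x h4
        rw [mem_opposite] at this
        omega
      simp only [h1, h2, if_true, and_true, if_neg this, add_zero]
    · by_cases h3 : sideOf a = side
      · rw [backlog_record ha o (hax.2 (by omega))]
        by_cases h4 : o = some x
        · have : a ∉ backlog h x := by simp [mem_backlog, ha]
          simp [h1, h2, h3, h4, Finset.sum_insert this]
          ring
        · simp [h1, h2, h4]
      · rw [backlog_record_of_notMem o (by rw [hax]; omega)]
        simp [h1, h2, h3]
  · simp [h1]

/-- The term of `a` disappears, and the only other term that changes is that of the chosen agent: it
receives the deposit `w a c` if `a` initiates and `c` can still respond. -/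
theorem sum_potTerm_record {side : ℕ} (hs : side ≤ 1) {A : Agent n m → Finset (Agent n m)}
    {w : Agent n m → Agent n m → ℝ} {V : Agent n m → ℝ} {h : History n m} {a : Agent n m}
    (ha : h a = none) {o : Option (Agent n m)} (ho : ∀ c, o = some c → c ∈ opposite a) :
    ∑ x, potTerm side F A w V (h.record a o) x = ∑ x, potTerm side F A w V h x -
      potTerm side F A w V h a +
      if sideOf a = side then o.elim 0 (fun c => if h c = none then w a c else 0) else 0 := by
  have h0 : potTerm side F A w V (h.record a o) a = 0 := by
    simp [potTerm, History.record_self]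
  have hsum : ∑ x ∈ Finset.univ.erase a,
      (if sideOf a = side ∧ o = some x ∧ h x = none then w a x else 0) =
      if sideOf a = side then o.elim 0 (fun c => if h c = none then w a c else 0) else 0 := by
    cases o with
    | none => simp
    | some c =>
      have hc : c ≠ a := by
        rintro rfl
        have := ho c rfl
        rw [mem_opposite] at this
        have := sideOf_le c
        omega
      rw [Finset.sum_eq_single c]
      · by_cases h1 : sideOf a = side <;> simp [h1]
      · intro x _ hx
        rw [if_neg]
        rintro ⟨_, h1, _⟩
        exact hx (Option.some.inj h1).symm
      · simp [hc]
  rw [← Finset.add_sum_erase _ _ (Finset.mem_univ a), h0,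
    ← Finset.add_sum_erase _ (potTerm side F A w V h) (Finset.mem_univ a),
    Finset.sum_congr rfl fun x hx => potTerm_record hs ha ho x (Finset.ne_of_mem_erase hx),
    Finset.sum_add_distrib, hsum]
  ring

/-- The reward collected so far plus the potential does not increase in expectation, whatever agent
is processed, so the potential bounds all future reward. The regime plays no role. -/
theorem Policy.reward_le (hφ : IsChoiceModel φ) (hF : Valuation φ K D F) {r : Regime}
    {side : ℕ} (hs : side ≤ 1) {A : Agent n m → Finset (Agent n m)}
    {w : Agent n m → Agent n m → ℝ} {V : Agent n m → ℝ}
    (hA : ∀ b, sideOf b ≠ side → A b ⊆ opposite b)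
    (hd : ∀ a, sideOf a = side → Dominates φ K F A a (w a) (V a)) (π : Policy n m) :
    ∀ h : History n m, π.Feasible D r h →
      π.reward φ side h ≤ ∑ x, potTerm side F A w V h x := by
  induction π with
  | finish =>
    intro h hf
    simp [reward, potTerm, hf _]
  | mix p π σ ih₁ ih₂ =>
    intro h hf
    have h1 := ih₁ h hf.2.1
    have h2 := ih₂ h hf.2.2
    have h3 := mul_le_mul_of_nonneg_left h1 hf.1.1
    have h4 := mul_le_mul_of_nonneg_left h2 (sub_nonneg.2 hf.1.2)
    rw [reward]
    linarith
  | display a S k ih =>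
    rintro h ⟨ha, _, hS, hD, hk⟩
    rw [reward]
    by_cases h1 : sideOf a = side
    · have := hφ.sum_le_sum hS (f := fun o =>
        (if sideOf a = side then 0 else gain h a o) + (k o).reward φ side (h.record a o))
        (g := fun o => (∑ x, potTerm side F A w V h x - potTerm side F A w V h a) +
          o.elim 0 (fun c => if h c = none then w a c else 0)) fun o ho => by
        have := ih o _ (hk o ho)
        rw [sum_potTerm_record hs ha (ho.mem_opposite hS), if_pos h1] at this
        simpa [h1] using this
      refine this.trans ?_
      rw [hφ.sum_const_add hS, hφ.sum_elim hS]
      -- Initiator: the expected deposit is at most the value of an assortment within the bound `K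
      -- a`, which the released `V a` covers.
      obtain ⟨S', hS', hc, hle⟩ := hF.initiate h a S hS hD (w a) fun c hc => ((hd a h1).1 c hc).1
      have h2 := (hd a h1).2 S' hS' hc
      have h3 : potTerm side F A w V h a = V a := by simp [potTerm, ha, h1]
      linarith
    · have := hφ.sum_le_sum hS (f := fun o =>
        (if sideOf a = side then 0 else gain h a o) + (k o).reward φ side (h.record a o))
        (g := fun o => (∑ x, potTerm side F A w V h x - potTerm side F A w V h a) +
          o.elim 0 (fun c => if h c = some (some a) then 1 else 0)) fun o ho => by
        have := ih o _ (hk o ho)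
        rw [sum_potTerm_record hs ha (ho.mem_opposite hS), if_neg h1] at this
        simp only [h1, if_false, gain]
        linarith
      refine this.trans ?_
      rw [hφ.sum_const_add hS, hφ.sum_elim hS]
      have h2 := hF.respond h a S ha hS hD
      have h3 : potTerm side F A w V h a = F a (A a) + ∑ c ∈ backlog h a, w c a := by
        simp [potTerm, ha, h1]
      -- Responder: the deposits were made by the members of the backlog, and each is at least the
      -- marginal value over `A a`. So they lift `F a (A a)` to the value of `A a ∪ backlog h a`,
      -- which is at least that of the backlog.
      have h4 := hF.union_le (hA a h1) (w := fun c => w c a) (backlog h a) (backlog_subset h a)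
        fun c hc => by
          have hc' := backlog_subset h a hc
          have hca := mem_opposite.1 hc'
          have := sideOf_le a
          exact ((hd c (by omega)).1 a (mem_opposite_comm.1 hc')).2
      have h5 := hF.mono a (backlog h a) (A a ∪ backlog h a) Finset.subset_union_right
        (Finset.union_subset (hA a h1) (backlog_subset h a))
      linarith

/-- Upper bounds for the reward, as obtained from any dominating values. -/
def RewardBound (φ : Choice n m) (K : Agent n m → ℕ) (F : Agent n m → Finset (Agent n m) → ℝ)
    (side : ℕ) (X : ℝ) : Prop :=
  ∀ (A : Agent n m → Finset (Agent n m)) (w : Agent n m → Agent n m → ℝ) (V : Agent n m → ℝ),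
    (∀ b, sideOf b ≠ side → A b ⊆ opposite b) →
    (∀ a, sideOf a = side → Dominates φ K F A a (w a) (V a)) →
    X ≤ ∑ x, if sideOf x = side then V x else F x (A x)

/-- With empty backlogs the potential is the dual objective. It does not mention the policy, so the
outcome of the greedy policy may be inserted for `A`, `w` and `V`. -/
theorem Policy.rewardBound (hφ : IsChoiceModel φ) (hF : Valuation φ K D F) {r : Regime}
    {side : ℕ} (hs : side ≤ 1) (π : Policy n m) (hπ : π.Feasible D r History.init) :
    RewardBound φ K F side (π.reward φ side History.init) := by
  intro A w V hA hd
  refine (π.reward_le hφ hF hs hA hd _ hπ).trans (Finset.sum_le_sum fun x _ => ?_)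
  have : backlog (History.init : History n m) x = ∅ := by
    ext; simp [mem_backlog, History.init]
  rw [potTerm, this]
  simp [History.init]

end

/-! ### The greedy program -/

theorem mem_readSet {s : Store} {a c : Agent n m} {x r : ℕ} :
    c ∈ readSet s a x r ↔ c ∈ opposite a ∧ s.nat x r (number c) ≠ 0 := by simp [readSet]

theorem readSet_subset (s : Store) (a : Agent n m) (x r : ℕ) : readSet s a x r ⊆ opposite a :=
  Finset.filter_subset _ _

theorem readSet_congr {s s' : Store} {x : ℕ} (h : s'.nat x = s.nat x) (a : Agent n m) (r : ℕ) :
    readSet s' a x r = readSet s a x r := by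
  simp [readSet, h]

/-- The loop in which the agents of the responding side are processed. -/
def respondLoop (side : ℕ) (respond : Cmd) (x : ℕ) (r : NExp) : Cmd :=
  forLoop 5 (.get 0 (.lit 0) (.lit (1 - side)))
    (.seq respond (.display (.lit (1 - side)) (nvar 5) x r 3 (.lit 0) (.lit 0)))

/-- The loop body that processes one agent of the initiating side. -/
def initiateBody (side : ℕ) (val : Cmd) (e : RExp) (select : Cmd) (x : ℕ) (r : NExp) : Cmd :=
  .seq (forLoop 5 (.get 0 (.lit 0) (.lit (1 - side)))
      (.seq val (.rset 2 (.lit 0) (nvar 5) e)))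
    (.seq select
      (.seq (.display (.lit side) (nvar 4) x r 3 (.lit 0) (.lit 0))
        (.nset 2 (nvar 3) (nvar 4) (.lit 1))))

/-- The greedy program with initiating side `side`: each initiating agent is shown an assortment
(computed by `select`) that is optimal for the marginal values (computed by `val`) of the agents of
the other side, and each responding agent is shown an assortment (computed by `respond`) that is
optimal for its backlog. The row number `number b + 1` of the array `2` holds the backlog of `b`. -/
def greedyProgram (side : ℕ) (val : Cmd) (e : RExp) (select : Cmd) (x : ℕ) (r : NExp)
    (respond : Cmd) (x' : ℕ) (r' : NExp) : Cmd :=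
  .seq (forLoop 4 (.get 0 (.lit 0) (.lit side)) (initiateBody side val e select x r))
    (respondLoop side respond x' r')

/-- The memory `s` holds the input `s₀` and the backlogs of the history `h`. -/
def Tracks (s₀ : Store) (side : ℕ) (h : History n m) (s : Store) : Prop :=
  Keep 2 s₀ s ∧ ∀ b : Agent n m, sideOf b = 1 - side →
    readSet s b 2 (number b + 1) = backlog h b

theorem Tracks.keep {s₀ s s' : Store} {side : ℕ} {h : History n m} (hs : Tracks s₀ side h s)
    (hk : Keep 3 s s') : Tracks s₀ side h s' :=
  ⟨hs.1.trans (hk.anti (by omega)), fun b hb => by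
    rw [readSet_congr (hk.1 2 (by omega)), hs.2 b hb]⟩

theorem Tracks.keep_two {s₀ s s' : Store} {side : ℕ} {h : History n m} (hs : Tracks s₀ side h s)
    (hk : Keep 2 s s') (h2 : s'.nat 2 = s.nat 2) : Tracks s₀ side h s' :=
  ⟨hs.1.trans hk, fun b hb => by rw [readSet_congr h2, hs.2 b hb]⟩

/-- The subroutines of the greedy program do what they should within given numbers of steps. -/
structure Subroutines (O : Oracles n m) (φ : Choice n m) (K : Agent n m → ℕ)
    (D : DisplayRule n m) (F : Agent n m → Finset (Agent n m) → ℝ) (s₀ : Store) (side : ℕ)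
    (val : Cmd) (e : RExp) (select : Cmd) (x : ℕ) (r : NExp) (respond : Cmd) (x' : ℕ) (r' : NExp)
    (tv tc tr : ℕ) : Prop where
  val : ∀ (h : History n m) s a b, sideOf a = side → sideOf b = 1 - side → h a = none →
    Tracks s₀ side h s → s.nat 4 0 0 = number a → s.nat 5 0 0 = number b →
    ∃ s', Det O val tv s s' ∧ Keep 6 s s' ∧
      e.eval s' = F b (insert a (backlog h b)) - F b (backlog h b)
  select : ∀ s (a : Agent n m), sideOf a = side → Keep 2 s₀ s → s.nat 4 0 0 = number a →
    (∀ c ∈ opposite a, 0 ≤ s.real 2 0 (number c)) →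
    ∃ s', Det O select tc s s' ∧ Keep 6 s s' ∧ (readSet s' a x (r.eval s')).card ≤ K a ∧
      ∀ S ⊆ opposite a, S.card ≤ K a → ∑ c ∈ S, s.real 2 0 (number c) * φ a S (some c) ≤
        ∑ c ∈ readSet s' a x (r.eval s'),
          s.real 2 0 (number c) * φ a (readSet s' a x (r.eval s')) (some c)
  respond : ∀ (h : History n m) s b, sideOf b = 1 - side → Tracks s₀ side h s →
    s.nat 5 0 0 = number b →
    ∃ s', Det O respond tr s s' ∧ Keep 6 s s' ∧ D h b (readSet s' b x' (r'.eval s')) ∧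
      F b (backlog h b) ≤ ∑ c ∈ readSet s' b x' (r'.eval s'),
        (if h c = some (some b) then 1 else 0) * φ b (readSet s' b x' (r'.eval s')) (some c)

/-- The estimated value of the backlog of `b` if `b` is still to respond. -/
def backlogValue (side : ℕ) (F : Agent n m → Finset (Agent n m) → ℝ) (h : History n m)
    (b : Agent n m) : ℝ :=
  if sideOf b = 1 - side ∧ h b = none then F b (backlog h b) else 0

/-! ### Analysis of the greedy program -/

section
variable {φ : Choice n m} {K : Agent n m → ℕ} {D : DisplayRule n m}
  {F : Agent n m → Finset (Agent n m) → ℝ} {O : Oracles n m} {s₀ : Store} {side : ℕ}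
  {val : Cmd} {e : RExp} {select : Cmd} {x : ℕ} {r : NExp} {respond : Cmd} {x' : ℕ} {r' : NExp}
  {tv tc tr : ℕ}

theorem sum_backlogValue_record_responder {h : History n m} {b : Agent n m}
    (hb : sideOf b = 1 - side) (hbn : h b = none) (o : Option (Agent n m)) :
    ∑ y, backlogValue side F (h.record b o) y =
      ∑ y, backlogValue side F h y - F b (backlog h b) := by
  have h1 : backlogValue side F (h.record b o) b = 0 := by
    simp [backlogValue, History.record_self]
  have h2 : backlogValue side F h b = F b (backlog h b) := by simp [backlogValue, hb, hbn]
  rw [← Finset.add_sum_erase _ _ (Finset.mem_univ b), h1,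
    ← Finset.add_sum_erase _ (backlogValue side F h) (Finset.mem_univ b), h2, zero_add,
    add_sub_cancel_left]
  refine Finset.sum_congr rfl fun y hy => ?_
  have hyb := Finset.ne_of_mem_erase hy
  unfold backlogValue
  rw [History.record_ne _ hyb]
  by_cases hys : sideOf y = 1 - side
  · rw [backlog_record_of_notMem]
    rw [mem_opposite]
    have := sideOf_le b
    omega
  · simp [hys]

theorem sum_backlogValue_record_initiator (hs : side ≤ 1) {h : History n m} {a : Agent n m}
    (ha : sideOf a = side) (han : h a = none) (hh : ∀ b, sideOf b = 1 - side → h b = none)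
    {o : Option (Agent n m)} (ho : ∀ c, o = some c → c ∈ opposite a) :
    ∑ y, backlogValue side F (h.record a o) y = ∑ y, backlogValue side F h y +
      o.elim 0 (fun c => F c (insert a (backlog h c)) - F c (backlog h c)) := by
  have h1 : ∀ y, backlogValue side F (h.record a o) y = backlogValue side F h y +
      if o = some y then F y (insert a (backlog h y)) - F y (backlog h y) else 0 := by
    intro y
    unfold backlogValue
    by_cases hy : sideOf y = 1 - side
    · have hya : y ≠ a := by rintro rfl; omega
      have hay : a ∈ opposite y := mem_opposite.2 (by omega)
      rw [History.record_ne _ hya, backlog_record han o hay]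
      by_cases hoy : o = some y
      · simp [hy, hh y hy, hoy]
      · simp [hy, hh y hy, hoy]
    · have : o ≠ some y := by
        rintro rfl
        have := mem_opposite.1 (ho y rfl)
        omega
      simp [hy, this]
  rw [Finset.sum_congr rfl fun y _ => h1 y, Finset.sum_add_distrib]
  congr 1
  cases o <;> simp

/-- Each responder collects in expectation at least the value of its backlog and leaves the other
backlogs unchanged; induction on the number `d` of responders left. -/
theorem Subroutines.respond_phase (hφ : IsChoiceModel φ)
    (hsub : Subroutines O φ K D F s₀ side val e select x r respond x' r' tv tc tr)
    (hs : side ≤ 1) (hcount : ∀ i ≤ 1, s₀.nat 0 0 i = sideCard n m i)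
    {reg : Regime} (hreg : reg.StartsWith side) (d : ℕ) : ∀ (j : ℕ) (s : Store) (h : History n m),
    j + d = sideCard n m (1 - side) → Tracks s₀ side h s → s.nat 5 0 0 = j →
    (∀ a, sideOf a = side → h a ≠ none) →
    (∀ b, sideOf b = 1 - side → (h b = none ↔ j ≤ number b)) →
    ∃ π, Realizes O (d * (tr + 5) + 1) [whileLoop 5 (.get 0 (.lit 0) (.lit (1 - side)))
      (.seq respond (.display (.lit (1 - side)) (nvar 5) x' r' 3 (.lit 0) (.lit 0)))] s π ∧
      π.Feasible D reg h ∧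
      h.matches + ∑ y, backlogValue side F h y ≤ π.expectedMatches φ h := by
  induction d with
  | zero =>
    intro j s h hj hT hsj ha hb
    have hN : s.nat 0 0 (1 - side) = sideCard n m (1 - side) := by
      rw [hT.1.1 0 (by omega), hcount _ (by omega)]
    have hb' : ∀ b, sideOf b = 1 - side → h b ≠ none := fun b hbs hbn => by
      have := (hb b hbs).1 hbn
      have := number_lt b
      rw [hbs] at this
      omega
    refine ⟨.finish, ?_, ?_, ?_⟩
    · refine Det.while_false ?_ _ _ _ (.done _ s)
      simp [hN, hsj]; omega
    · intro a
      by_cases has : sideOf a = side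
      · exact ha a has
      · have := sideOf_le a
        exact hb' a (by omega)
    · rw [Policy.expectedMatches, Finset.sum_eq_zero]
      · simp
      · intro y _
        rw [backlogValue, if_neg]
        rintro ⟨h1, h2⟩
        exact hb' y h1 h2
  | succ d ih =>
    intro j s h hj hT hsj ha hb
    have hN : s.nat 0 0 (1 - side) = sideCard n m (1 - side) := by
      rw [hT.1.1 0 (by omega), hcount _ (by omega)]
    obtain ⟨b, hbs, hbj⟩ := exists_agent (n := n) (m := m) (side := 1 - side) (i := j)
      (by omega) (by omega)
    have hbn : h b = none := (hb b hbs).2 hbj.ge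
    obtain ⟨s₁, hdet, hkeep, hD, hval⟩ := hsub.respond h s b hbs hT (by rw [hsj, hbj])
    set S := readSet s₁ b x' (r'.eval s₁) with hSdef
    have hSo : S ⊆ opposite b := readSet_subset _ _ _ _
    have hs5 : s₁.nat 5 0 0 = j := by rw [hkeep.1 5 (by omega), hsj]
    -- The quantifier precedes the hypothesis so that `choose` yields a continuation for every
    -- answer; the impossible ones get `.finish`.
    have hrec : ∀ o, ∃ π, Possible S o →
        Realizes O (d * (tr + 5) + 1) [whileLoop 5 (.get 0 (.lit 0) (.lit (1 - side)))
          (.seq respond (.display (.lit (1 - side)) (nvar 5) x' r' 3 (.lit 0) (.lit 0)))]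
          ((s₁.setNat 3 0 0 (answerCode o)).setNat 5 0 0 (j + 1)) π ∧
        π.Feasible D reg (h.record b o) ∧
        (h.record b o).matches + ∑ y, backlogValue side F (h.record b o) y ≤
          π.expectedMatches φ (h.record b o) := by
      intro o
      by_cases ho : Possible S o
      · suffices h' : _ ∧ _ ∧ _ by
          obtain ⟨π, hπ⟩ := ih (j + 1)
            ((s₁.setNat 3 0 0 (answerCode o)).setNat 5 0 0 (j + 1)) (h.record b o) (by omega)
            h'.1 (by simp) h'.2.1 h'.2.2
          exact ⟨π, fun _ => hπ⟩
        refine ⟨?_, ?_, ?_⟩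
        · have hT' : Tracks s₀ side h ((s₁.setNat 3 0 0 (answerCode o)).setNat 5 0 0 (j + 1)) :=
            (hT.keep (hkeep.anti (by omega))).keep
              (((Keep.refl 3 s₁).setNat (by omega) _ _ _).setNat (by omega) _ _ _)
          refine ⟨hT'.1, fun c hc => ?_⟩
          rw [hT'.2 c hc, backlog_record_of_notMem]
          rw [mem_opposite]
          omega
        · intro a has
          rw [History.record_ne _ (by rintro rfl; omega)]
          exact ha a has
        · intro c hcs
          by_cases hc : c = b
          · subst hc
            simp [History.record_self, hbj]
          · rw [History.record_ne _ hc, hb c hcs]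
            have : number c ≠ j := fun h' => hc (number_inj (by rw [hcs, hbs]) (by rw [h', hbj]))
            omega
      · exact ⟨.finish, fun h' => absurd h' ho⟩
    choose k hk using hrec
    refine ⟨.display b S k, ?_, ⟨hbn, (hreg h b).2 fun _ a has => ha a has, hSo, hD,
      fun o ho => (hk o ho).2.1⟩, ?_⟩
    · refine (Realizes.det (T := d * (tr + 5) + 1 + 1 + 1 + tr + 1 + 1) (by
        simp [detStep, whileLoop, hN, hsj]
        rw [if_pos (by omega)]
        exact ⟨rfl, rfl⟩) ?_).mono (T' := (d + 1) * (tr + 5) + 1) (by ring_nf; omega)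
      refine .det rfl (.det rfl (hdet _ _ _ ?_))
      refine .display ?_ fun o ho => ?_
      · have := agentAt_number b
        rw [hbs, hbj] at this
        simpa [hs5] using this
      · refine Det.nset _ _ _ _ _ _ _ ?_
        have h3 : (s₁.setNat 3 0 0 (answerCode o)).nat 5 0 0 = j := by
          rw [Store.nat_setNat_ne _ (by omega), hs5]
        have h4 := (hk o ho).1
        rw [← h3] at h4
        exact h4
    · rw [Policy.expectedMatches]
      refine le_trans ?_ (hφ.sum_le_sum hSo (f := fun o =>
        (h.matches + (∑ y, backlogValue side F h y - F b (backlog h b))) + gain h b o)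
        fun o ho => ?_)
      · rw [hφ.sum_const_add hSo]
        unfold gain
        rw [hφ.sum_elim hSo]
        linarith
      · have := (hk o ho).2.2
        rw [matches_record hbn (ho.mem_opposite hSo),
          sum_backlogValue_record_responder hbs hbn] at this
        linarith

/-- By submodularity, larger reference sets have smaller marginal values. Hence prices fixed when
`a` was processed remain valid for all later backlogs. -/
theorem Dominates.mono (hF : Valuation φ K D F) {A B : Agent n m → Finset (Agent n m)}
    {a : Agent n m} {w : Agent n m → ℝ} {V : ℝ} (h : Dominates φ K F A a w V)
    (hAB : ∀ c ∈ opposite a, A c ⊆ B c ∧ B c ⊆ opposite c) : Dominates φ K F B a w V :=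
  ⟨fun c hc => ⟨(h.1 c hc).1, (hF.submod c _ _ (hAB c hc).1 (hAB c hc).2 a
    (mem_opposite_comm.1 hc)).trans (h.1 c hc).2⟩, h.2⟩

theorem backlog_subset_record {h : History n m} {a : Agent n m} (ha : h a = none)
    (o : Option (Agent n m)) (c : Agent n m) : backlog h c ⊆ backlog (h.record a o) c := by
  intro y hy
  rw [mem_backlog] at hy ⊢
  have : y ≠ a := by rintro rfl; simp [ha] at hy
  rwa [History.record_ne _ this]

/-- One mark in row `answerCode o` updates all backlogs at once: the outside option goes to row `0`,
which is the backlog of nobody. -/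
theorem Tracks.record {s s' : Store} {h : History n m} {a : Agent n m} (hs : side ≤ 1)
    (hT : Tracks s₀ side h s) (ha : sideOf a = side) (han : h a = none) {o : Option (Agent n m)}
    (ho : ∀ c, o = some c → c ∈ opposite a) (hk : Keep 2 s s')
    (h2 : ∀ i j, s'.nat 2 i j = if i = answerCode o ∧ j = number a then 1 else s.nat 2 i j) :
    Tracks s₀ side (h.record a o) s' := by
  refine ⟨hT.1.trans hk, fun b hb => ?_⟩
  have hab : a ∈ opposite b := mem_opposite.2 (by omega)
  have hba : b ∈ opposite a := mem_opposite.2 (by omega)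
  rw [backlog_record han o hab, ← hT.2 b hb]
  have hcode := answerCode_eq_iff hba ho
  ext c
  by_cases hc : c ∈ opposite b
  · have hca : number c = number a ↔ c = a :=
      ⟨fun h' => number_inj (by rw [mem_opposite] at hc; omega) h', fun h' => by rw [h']⟩
    by_cases hob : o = some b
    · have h3 := (hcode.2 hob).symm
      rw [if_pos hob, mem_readSet, h2, h3, Finset.mem_insert, mem_readSet]
      by_cases h4 : c = a
      · simp [h4, hab]
      · simp [h4, hca]
    · have h3 : ¬ (number b + 1 = answerCode o) := fun h' => hob (hcode.1 h'.symm)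
      simp [hob, mem_readSet, h2, hc, h3]
  · have : c ≠ a := by rintro rfl; exact hc hab
    split_ifs <;> simp [mem_readSet, hc, this]

theorem Subroutines.marginals (hsub :
      Subroutines O φ K D F s₀ side val e select x r respond x' r' tv tc tr)
    (hs : side ≤ 1) (hcount : ∀ i ≤ 1, s₀.nat 0 0 i = sideCard n m i) {s : Store}
    {h : History n m} {a : Agent n m} (ha : sideOf a = side) (han : h a = none)
    (hT : Tracks s₀ side h s) (hsa : s.nat 4 0 0 = number a) :
    ∃ s', Det O (forLoop 5 (.get 0 (.lit 0) (.lit (1 - side)))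
        (.seq val (.rset 2 (.lit 0) (nvar 5) e))) (sideCard n m (1 - side) * (tv + 5) + 3) s s' ∧
      Tracks s₀ side h s' ∧ s'.nat 4 0 0 = number a ∧
      ∀ c ∈ opposite a,
        s'.real 2 0 (number c) = F c (insert a (backlog h c)) - F c (backlog h c) := by
  obtain ⟨s', hdet, hI1, hI2, hI3⟩ := Det.forLoop (O := O) (k := 5)
    (N := .get 0 (.lit 0) (.lit (1 - side)))
    (c := .seq val (.rset 2 (.lit 0) (nvar 5) e)) (t := tv + 1 + 1) (M := sideCard n m (1 - side))
    (fun j s₁ => Tracks s₀ side h s₁ ∧ s₁.nat 4 0 0 = number a ∧ ∀ c ∈ opposite a, number c < j →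
      s₁.real 2 0 (number c) = F c (insert a (backlog h c)) - F c (backlog h c))
    (fun j s₁ hI => by
      simp only [NExp.eval_get, NExp.eval_lit]
      rw [hI.1.1.1 0 (by omega), hcount _ (by omega)])
    (fun j s₁ v hI => ⟨hI.1.keep ((Keep.refl _ _).setNat (by omega) _ _ _),
      by rw [Store.nat_setNat_ne _ (by omega), hI.2.1], hI.2.2⟩)
    (fun j hj s₁ hI hs5 => by
      obtain ⟨b, hbs, hbj⟩ := exists_agent (n := n) (m := m) (side := 1 - side) (by omega) hj
      obtain ⟨s₂, hdet, hkeep, he⟩ := hsub.val h s₁ a b ha hbs han hI.1 hI.2.1 (by rw [hs5, hbj])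
      have h5 : s₂.nat 5 0 0 = j := by rw [hkeep.1 5 (by omega), hs5]
      refine ⟨_, hdet.seq (Det.rset _ _ _ _), by simpa using h5, ?_, ?_, ?_⟩
      · exact (hI.1.keep (hkeep.anti (by omega))).keep_two
          ((Keep.refl _ _).setReal (by omega) _ _ _) rfl
      · simp [hkeep.1 4 (by omega), hI.2.1]
      · intro c hc hcj
        simp only [NExp.eval_lit, NExp.eval_nvar, h5, he, Store.real_setReal, true_and]
        rw [mem_opposite] at hc
        by_cases hcb : c = b
        · simp [hcb, hbj]
        · have : number c ≠ j := fun h' => hcb (number_inj (by omega) (by rw [h', hbj]))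
          rw [if_neg this, hkeep.2 2 (by omega)]
          exact hI.2.2 c (mem_opposite.2 hc) (by omega))
    ⟨hT, hsa, fun _ _ h' => by omega⟩
  refine ⟨s', hdet, hI1, hI2, fun c hc => hI3 c hc ?_⟩
  have := number_lt c
  rw [mem_opposite] at hc
  rwa [hc, ha] at this

/-- The number of steps of the greedy program. -/
def greedyTime (z tv tc tr : ℕ) : ℕ := z * (z * (tv + 5) + tc + 11) + (z * (tr + 5) + 10)

/-- The dual values of the processed initiators are arbitrary dominating ones, since they are fixed
by the path. The future `V a` are eliminated: their expected sum is the expected final backlog value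
minus the current one, and the final value is at most the expected matches. This explains both the
factor `2` and the subtracted term. -/
theorem Subroutines.initiate_phase (hφ : IsChoiceModel φ) (hF : Valuation φ K D F)
    (hD : ∀ (h : History n m) a S, S ⊆ opposite a → S.card ≤ K a → (∀ b ∈ S, h b = none) → D h a S)
    (hsub : Subroutines O φ K D F s₀ side val e select x r respond x' r' tv tc tr)
    (hs : side ≤ 1) (hcount : ∀ i ≤ 1, s₀.nat 0 0 i = sideCard n m i)
    {reg : Regime} (hreg : reg.StartsWith side) (d : ℕ) : ∀ (i : ℕ) (s : Store) (h : History n m),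
    i + d = sideCard n m side → Tracks s₀ side h s → s.nat 4 0 0 = i →
    (∀ a, h a = none ↔ ¬ (sideOf a = side ∧ number a < i)) →
    ∃ π, Realizes O (d * (sideCard n m (1 - side) * (tv + 5) + tc + 11) +
        (sideCard n m (1 - side) * (tr + 5) + 4))
      [whileLoop 4 (.get 0 (.lit 0) (.lit side)) (initiateBody side val e select x r),
        respondLoop side respond x' r'] s π ∧
      π.Feasible D reg h ∧
      ∀ X, RewardBound φ K F side X → ∀ (w : Agent n m → Agent n m → ℝ) (V : Agent n m → ℝ),
        (∀ a, sideOf a = side → h a ≠ none → Dominates φ K F (backlog h) a (w a) (V a)) →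
        X ≤ ∑ y, (if sideOf y = side ∧ h y ≠ none then V y else 0) +
          2 * π.expectedMatches φ h - ∑ y, backlogValue side F h y := by
  induction d with
  | zero =>
    intro i s h hi hT hsi hh
    have hN : s.nat 0 0 side = sideCard n m side := by
      rw [hT.1.1 0 (by omega), hcount _ (by omega)]
    have hside : ∀ a, sideOf a = side → h a ≠ none := fun a has han => by
      have := number_lt a
      rw [has] at this
      exact (hh a).1 han ⟨has, by omega⟩
    have hother : ∀ b, sideOf b = 1 - side → h b = none := fun b hb =>
      (hh b).2 fun h' => by omega
    obtain ⟨π, hreal, hfeas, hval⟩ := hsub.respond_phase hφ hs hcount hreg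
      (sideCard n m (1 - side)) 0 (s.setNat 5 0 0 0) h (by omega)
      (hT.keep ((Keep.refl _ _).setNat (by omega) _ _ _)) (by simp) hside
      (fun b hb => by simp [hother b hb])
    refine ⟨π, ?_, hfeas, fun X hX w V hd => ?_⟩
    · refine (Det.while_false (by simp [hN, hsi]; omega) _ _ _ ?_).mono
        (T := sideCard n m (1 - side) * (tr + 5) + 3 + 1) (by omega)
      exact .det rfl (Det.nset _ _ _ _ _ _ _ hreal)
    -- All initiators are processed, so duality applies with the realized backlogs. The matches are
    -- worth at least the total backlog value, so twice the matches minus that value is at least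
    -- that value.
    · have h1 := hX (backlog h) w V (fun b _ => backlog_subset h b)
        fun a ha => hd a ha (hside a ha)
      have h2 : (∑ y, if sideOf y = side then V y else F y (backlog h y)) =
          ∑ y, (if sideOf y = side ∧ h y ≠ none then V y else 0) +
            ∑ y, backlogValue side F h y := by
        rw [← Finset.sum_add_distrib]
        refine Finset.sum_congr rfl fun y _ => ?_
        by_cases hy : sideOf y = side
        · simp [hy, hside y hy, backlogValue]
        · have hy' : sideOf y = 1 - side := by have := sideOf_le y; omega
          rw [if_neg hy, if_neg (by tauto), zero_add, backlogValue, if_pos ⟨hy', hother y hy'⟩]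
      have h3 : (0 : ℝ) ≤ h.matches := Nat.cast_nonneg _
      linarith
  | succ d ih =>
    intro i s h hi hT hsi hh
    have hN : s.nat 0 0 side = sideCard n m side := by
      rw [hT.1.1 0 (by omega), hcount _ (by omega)]
    obtain ⟨a, has, hai⟩ := exists_agent (n := n) (m := m) (side := side) (i := i) hs (by omega)
    have han : h a = none := (hh a).2 (by omega)
    have hother : ∀ b, sideOf b = 1 - side → h b = none := fun b hb =>
      (hh b).2 fun h' => by omega
    obtain ⟨s₁, hdet₁, hT₁, hs₁, hθ⟩ := hsub.marginals hs hcount has han hT (by rw [hsi, hai])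
    set θ : Agent n m → ℝ := fun c => F c (insert a (backlog h c)) - F c (backlog h c) with hθdef
    have hθ0 : ∀ c ∈ opposite a, 0 ≤ θ c := fun c hc =>
      sub_nonneg.2 (hF.mono c _ _ (Finset.subset_insert _ _)
        (Finset.insert_subset (mem_opposite_comm.1 hc) (backlog_subset h c)))
    obtain ⟨s₂, hdet₂, hkeep₂, hcard, hopt⟩ := hsub.select s₁ a has hT₁.1 hs₁
      fun c hc => by rw [hθ c hc]; exact hθ0 c hc
    set S := readSet s₂ a x (r.eval s₂) with hSdef
    have hSo : S ⊆ opposite a := readSet_subset _ _ _ _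
    have hopt' : ∀ S' ⊆ opposite a, S'.card ≤ K a →
        ∑ c ∈ S', θ c * φ a S' (some c) ≤ ∑ c ∈ S, θ c * φ a S (some c) := by
      intro S' hS' hc'
      have h1 := hopt S' hS' hc'
      rwa [Finset.sum_congr rfl fun c hc => by rw [hθ c (hS' hc)],
        Finset.sum_congr (s₁ := S) rfl fun c hc => by rw [hθ c (hSo hc)]] at h1
    have hs₂4 : s₂.nat 4 0 0 = i := by rw [hkeep₂.1 4 (by omega), hs₁, hai]
    have hrec : ∀ o, ∃ π, Possible S o →
        Realizes O (d * (sideCard n m (1 - side) * (tv + 5) + tc + 11) +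
            (sideCard n m (1 - side) * (tr + 5) + 4))
          [whileLoop 4 (.get 0 (.lit 0) (.lit side)) (initiateBody side val e select x r),
            respondLoop side respond x' r']
          (((s₂.setNat 3 0 0 (answerCode o)).setNat 2 (answerCode o) i 1).setNat 4 0 0 (i + 1)) π ∧
        π.Feasible D reg (h.record a o) ∧
        ∀ X, RewardBound φ K F side X → ∀ (w : Agent n m → Agent n m → ℝ) (V : Agent n m → ℝ),
          (∀ a', sideOf a' = side → h.record a o a' ≠ none →
            Dominates φ K F (backlog (h.record a o)) a' (w a') (V a')) →
          X ≤ ∑ y, (if sideOf y = side ∧ h.record a o y ≠ none then V y else 0) +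
            2 * π.expectedMatches φ (h.record a o) -
            ∑ y, backlogValue side F (h.record a o) y := by
      intro o
      by_cases ho : Possible S o
      · suffices h' : _ ∧ _ by
          obtain ⟨π, hπ⟩ := ih (i + 1)
            (((s₂.setNat 3 0 0 (answerCode o)).setNat 2 (answerCode o) i 1).setNat 4 0 0 (i + 1))
            (h.record a o) (by omega) h'.1 (by simp) h'.2
          exact ⟨π, fun _ => hπ⟩
        refine ⟨?_, ?_⟩
        · refine hT₁.record hs has han (ho.mem_opposite hSo)
            ((hkeep₂.anti (by omega)).trans ((((Keep.refl _ _).setNat (by omega) _ _ _).setNat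
              (by omega) _ _ _).setNat (by omega) _ _ _)) fun i' j' => ?_
          rw [Store.nat_setNat_ne _ (by omega), Store.nat_setNat,
            Store.nat_setNat_ne _ (by omega), hkeep₂.1 2 (by omega), hai]
          simp
        · intro c
          by_cases hc : c = a
          · subst hc
            simp [History.record_self, has, hai]
          · rw [History.record_ne _ hc, hh c]
            have : sideOf c = side → number c ≠ i := fun h1 h2 =>
              hc (number_inj (by rw [h1, has]) (by rw [h2, hai]))
            constructor
            · rintro h1 ⟨h2, h3⟩
              have := this h2
              exact h1 ⟨h2, by omega⟩
            · rintro h1 ⟨h2, h3⟩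
              exact h1 ⟨h2, by omega⟩
      · exact ⟨.finish, fun h' => absurd h' ho⟩
    choose k hk using hrec
    refine ⟨.display a S k, ?_, ⟨han, (hreg h a).2 fun h' => absurd has h', hSo,
      hD h a S hSo hcard fun b hb => hother b (by rw [← has]; exact mem_opposite.1 (hSo hb)),
      fun o ho => (hk o ho).2.1⟩, fun X hX w V hd => ?_⟩
    · refine (Realizes.det (T := d * (sideCard n m (1 - side) * (tv + 5) + tc + 11) +
            (sideCard n m (1 - side) * (tr + 5) + 4) + 1 + 1 + 1 + 1 + tc + 1 +
            (sideCard n m (1 - side) * (tv + 5) + 3) + 1 + 1) (by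
        simp [detStep, whileLoop, hN, hsi]
        rw [if_pos (by omega)]
        exact ⟨rfl, rfl⟩) ?_).mono (by ring_nf; omega)
      refine .det rfl (.det rfl (hdet₁ _ _ _ (.det rfl (hdet₂ _ _ _ (.det rfl ?_)))))
      refine .display ?_ fun o ho => ?_
      · have := agentAt_number a
        rw [has, hai] at this
        simpa [hs₂4] using this
      · refine Det.nset _ _ _ _ _ _ _ (Det.nset _ _ _ _ _ _ _ ?_)
        have h4 := (hk o ho).1
        have h3 : (s₂.setNat 3 0 0 (answerCode o)).nat 4 0 0 = i := by
          rw [Store.nat_setNat_ne _ (by omega), hs₂4]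
        have h5 : ((s₂.setNat 3 0 0 (answerCode o)).setNat 2 (answerCode o) i 1).nat 4 0 0 = i := by
          rw [Store.nat_setNat_ne _ (by omega), h3]
        simp only [NExp.eval_lit, NExp.eval_nvar, NExp.eval_add, h3, h5,
          Store.nat_setNat_self]
        exact h4
    · have hstep : ∀ o, Possible S o →
          X ≤ (∑ y, (if sideOf y = side ∧ h y ≠ none then V y else 0) +
              ∑ c ∈ S, θ c * φ a S (some c) - ∑ y, backlogValue side F h y) +
            (2 * (k o).expectedMatches φ (h.record a o) - o.elim 0 θ) := by
        intro o ho
        -- The dual values of `a` are its marginal values `θ` before its answer and the optimum for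
        -- them; after the answer they still dominate.
        have h1 := (hk o ho).2.2 X hX (Function.update w a θ)
          (Function.update V a (∑ c ∈ S, θ c * φ a S (some c))) fun a' ha' hn => by
            by_cases haa : a' = a
            · subst haa
              rw [Function.update_self, Function.update_self]
              refine Dominates.mono hF (A := backlog h) ⟨fun c hc => ⟨hθ0 c hc, le_rfl⟩, hopt'⟩
                fun c _ => ⟨backlog_subset_record han o c, backlog_subset _ c⟩
            · rw [Function.update_of_ne haa, Function.update_of_ne haa]
              rw [History.record_ne _ haa] at hn
              exact (hd a' ha' hn).mono hF
                fun c _ => ⟨backlog_subset_record han o c, backlog_subset _ c⟩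
        rw [sum_backlogValue_record_initiator hs has han hother (ho.mem_opposite hSo)] at h1
        have h2 : (∑ y, if sideOf y = side ∧ h.record a o y ≠ none then
            Function.update V a (∑ c ∈ S, θ c * φ a S (some c)) y else 0) =
            ∑ y, (if sideOf y = side ∧ h y ≠ none then V y else 0) +
              ∑ c ∈ S, θ c * φ a S (some c) := by
          rw [← Finset.add_sum_erase _ _ (Finset.mem_univ a),
            ← Finset.add_sum_erase _ (fun y => if sideOf y = side ∧ h y ≠ none then V y else 0)
              (Finset.mem_univ a), Finset.sum_congr (s₁ := Finset.univ.erase a) rfl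
              (g := fun y => if sideOf y = side ∧ h y ≠ none then V y else 0) (fun y hy => by
              rw [History.record_ne _ (Finset.ne_of_mem_erase hy),
                Function.update_of_ne (Finset.ne_of_mem_erase hy)])]
          rw [if_pos ⟨has, by simp [History.record_self]⟩, if_neg (by simp [han]),
            Function.update_self]
          ring
        rw [h2] at h1
        linarith
      -- On average over the answers, the increase `o.elim 0 θ` of the backlog value equals the new
      -- value of `V` at `a`, so the two cancel.
      have h1 := hφ.sum_le_sum hSo (f := fun _ => X) hstep
      rw [← Finset.sum_mul, hφ.sum_eq_one hSo, one_mul, hφ.sum_const_add hSo] at h1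
      simp only [mul_sub, Finset.sum_sub_distrib] at h1
      rw [hφ.sum_elim hSo] at h1
      rw [Policy.expectedMatches]
      have h2 : ∑ o, φ a S o * (2 * (k o).expectedMatches φ (h.record a o)) =
          2 * ∑ o, φ a S o * (k o).expectedMatches φ (h.record a o) := by
        rw [Finset.mul_sum]
        exact Finset.sum_congr rfl fun o _ => by ring
      rw [h2] at h1
      linarith

/-- The greedy program carries out a feasible policy and earns at least half of every reward bound
for its initiating side. -/
theorem Subroutines.greedyProgram (hφ : IsChoiceModel φ) (hF : Valuation φ K D F)
    (hD : ∀ (h : History n m) a S, S ⊆ opposite a → S.card ≤ K a → (∀ b ∈ S, h b = none) → D h a S)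
    (hsub : Subroutines O φ K D F s₀ side val e select x r respond x' r' tv tc tr)
    (hs : side ≤ 1) (hcount : ∀ i ≤ 1, s₀.nat 0 0 i = sideCard n m i)
    {reg : Regime} (hreg : reg.StartsWith side) {s : Store} (hk : Keep 2 s₀ s)
    (h2 : ∀ i j, s.nat 2 i j = 0) :
    ∃ π : Policy n m, Realizes O (greedyTime (n + m) tv tc tr)
      [greedyProgram side val e select x r respond x' r'] s π ∧
      π.Feasible D reg History.init ∧
      ∀ X, RewardBound φ K F side X → 1 / 2 * X ≤ π.expectedMatches φ History.init := by
  have hb : ∀ b, backlog (History.init : History n m) b = ∅ := fun b => by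
    ext; simp [mem_backlog, History.init]
  obtain ⟨π, hreal, hfeas, hval⟩ := hsub.initiate_phase hφ hF hD hs hcount hreg
    (sideCard n m side) 0 (s.setNat 4 0 0 0) History.init (by omega)
    (Tracks.keep ⟨hk, fun b _ => by
      rw [hb]; ext c; simp [mem_readSet, h2]⟩ ((Keep.refl _ _).setNat (by omega) _ _ _))
    (by simp) (by simp [History.init])
  refine ⟨π, ?_, hfeas, fun X hX => ?_⟩
  · refine (Realizes.det rfl (.det rfl (Det.nset _ _ _ _ _ _ _ hreal))).mono ?_
    have h1 := sideCard_le n m side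
    have h2 := sideCard_le n m (1 - side)
    have h3 : sideCard n m side * (sideCard n m (1 - side) * (tv + 5) + tc + 11) +
        (sideCard n m (1 - side) * (tr + 5) + 4) ≤
        (n + m) * ((n + m) * (tv + 5) + tc + 11) + ((n + m) * (tr + 5) + 4) := by gcongr
    unfold greedyTime
    omega
  -- Nobody is processed yet, so the dual values are irrelevant and the initial backlog value can be
  -- dropped as nonnegative.
  · have h1 := hval X hX (fun _ _ => 0) (fun _ => 0) fun a _ h' => absurd rfl h'
    have h3 : 0 ≤ ∑ y, backlogValue side F (History.init : History n m) y :=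
      Finset.sum_nonneg fun y _ => by
        unfold backlogValue
        rw [hb]
        split_ifs
        exacts [hF.empty y, le_rfl]
    simp only [ite_self, Finset.sum_const_zero, zero_add] at h1
    linarith

end

/-! ### Approximation for the three problems -/

theorem Policy.Feasible.fullyAdaptive {D : DisplayRule n m} {r : Regime} {π : Policy n m} :
    ∀ {h : History n m}, π.Feasible D r h → π.Feasible D .fullyAdaptive h := by
  induction π with
  | finish => exact fun h => h
  | mix p π σ ih₁ ih₂ => exact fun h => ⟨h.1, ih₁ h.2.1, ih₂ h.2.2⟩
  | display a S k ih =>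
    exact fun h => ⟨h.1, trivial, h.2.2.1, h.2.2.2.1, fun o ho => ih o (h.2.2.2.2 o ho)⟩

/-- The program for a regime, given for each side a program in which that side initiates. In the
fully adaptive regime, a fair coin decides which side initiates. -/
def regimeProgram (G : ℕ → Cmd) : Regime → Cmd
  | .customersFirst => G 0
  | .suppliersFirst => G 1
  | .fullyAdaptive => .seq (.coin 7 (.lit 0) (.lit 0)) (.ite (.nle (nvar 7) (.lit 0)) (G 0) (G 1))

theorem matches_init : (History.init : History n m).matches = 0 := by
  simp [History.matches, History.init]

/-- Since `RewardBound` holds for every feasible policy, the one-sided greedy programs can also be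
compared with fully adaptive policies: each earns half of the reward for its own side. In `hG` the
regime `reg'` of the greedy run is separate from `reg`, because the coin leads to a one-sided run
inside the fully adaptive problem. -/
theorem regimeProgram_isApprox {φ : Choice n m} {K : Agent n m → ℕ} {D : DisplayRule n m}
    {F : Agent n m → Finset (Agent n m) → ℝ} {O : Oracles n m} {s₀ : Store} {T : ℕ}
    {G : ℕ → Cmd} (reg : Regime) (hφ : IsChoiceModel φ) (hF : Valuation φ K D F)
    (h2 : ∀ i j, s₀.nat 2 i j = 0)
    (hG : ∀ side ≤ 1, (∀ a : Agent n m, sideOf a = side → reg.Initiates a) →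
      ∀ reg' : Regime, reg'.StartsWith side → ∀ s : Store, Keep 2 s₀ s →
      (∀ i j, s.nat 2 i j = 0) → ∃ π : Policy n m, Realizes O T [G side] s π ∧
        π.Feasible D reg' History.init ∧
        ∀ X, RewardBound φ K F side X → 1 / 2 * X ≤ π.expectedMatches φ History.init) :
    ∃ π : Policy n m, Realizes O (T + 3) [regimeProgram G reg] s₀ π ∧
      IsApprox φ D reg reg.factor π := by
  have hdec : ∀ {r : Regime} {σ : Policy n m}, σ.Feasible D r History.init →
      σ.expectedMatches φ History.init =
        σ.reward φ 0 History.init + σ.reward φ 1 History.init := fun {r σ} hσ => by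
    rw [σ.expectedMatches_eq hφ _ hσ, matches_init]; simp
  cases reg with
  | customersFirst =>
    obtain ⟨π, hr, hf, hv⟩ := hG 0 (by omega)
      (by rintro (_ | _) h <;> simp_all [sideOf, Regime.Initiates])
      _ Regime.startsWith_customersFirst s₀ (Keep.refl _ _) h2
    refine ⟨π, hr.mono (by omega), hf, fun σ hσ => ?_⟩
    rw [hdec hσ, σ.reward_eq_zero hφ (side := 0) (by omega) Regime.startsWith_customersFirst _ hσ
      (by simp [History.init]), add_zero]
    exact hv _ (σ.rewardBound hφ hF (by omega) hσ)
  | suppliersFirst =>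
    obtain ⟨π, hr, hf, hv⟩ := hG 1 (by omega)
      (by rintro (_ | _) h <;> simp_all [sideOf, Regime.Initiates])
      _ Regime.startsWith_suppliersFirst s₀ (Keep.refl _ _) h2
    refine ⟨π, hr.mono (by omega), hf, fun σ hσ => ?_⟩
    have h0 := σ.reward_eq_zero hφ (side := 1) (by omega) Regime.startsWith_suppliersFirst _ hσ
      (by simp [History.init])
    rw [hdec hσ, h0, zero_add]
    exact hv _ (σ.rewardBound hφ hF (by omega) hσ)
  | fullyAdaptive =>
    have hk : ∀ v, Keep 2 s₀ (s₀.setNat 7 0 0 v) := fun v =>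
      (Keep.refl _ _).setNat (by omega) _ _ _
    have h2' : ∀ v i j, (s₀.setNat 7 0 0 v).nat 2 i j = 0 := fun v i j => by
      rw [Store.nat_setNat_ne _ (by omega), h2]
    obtain ⟨π₀, hr₀, hf₀, hv₀⟩ := hG 0 (by omega) (fun _ _ => trivial)
      _ Regime.startsWith_customersFirst _ (hk 0) (h2' 0)
    obtain ⟨π₁, hr₁, hf₁, hv₁⟩ := hG 1 (by omega) (fun _ _ => trivial)
      _ Regime.startsWith_suppliersFirst _ (hk 1) (h2' 1)
    -- The three additional steps are the sequencing, the coin and the test of its outcome.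
    refine ⟨.mix (1 / 2) π₀ π₁, .det rfl (.coin (.det (s' := s₀.setNat 7 0 0 0) ?_ hr₀)
      (.det (s' := s₀.setNat 7 0 0 1) ?_ hr₁)), ⟨by norm_num, hf₀.fullyAdaptive,
      hf₁.fullyAdaptive⟩, fun σ hσ => ?_⟩
    · simp [detStep]
    · simp [detStep]
    · rw [hdec hσ, Policy.expectedMatches]
      have h0 := hv₀ _ (σ.rewardBound hφ hF (by omega) hσ)
      have h1 := hv₁ _ (σ.rewardBound hφ hF (by omega) hσ)
      simp only [Regime.factor]
      linarith

/-! ### The one-way constrained setting -/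

section
variable {φ : Choice n m} {K : Agent n m → ℕ}

theorem demand_empty (φ : Choice n m) (a : Agent n m) : demand φ a ∅ = 0 := by simp [demand]

theorem sum_ite_mul_eq_filter (S : Finset (Agent n m)) (p : Agent n m → Prop) [DecidablePred p]
    (θ g : Agent n m → ℝ) :
    ∑ c ∈ S, (if p c then θ c else 0) * g c = ∑ c ∈ S.filter p, θ c * g c := by
  rw [Finset.sum_filter]
  exact Finset.sum_congr rfl fun c _ => by split_ifs <;> simp

/-- Only a part of a displayed assortment counts: the backlog when responding, the unprocessed
agents when initiating. Under weak substitutability, hiding the rest makes this part more likely to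
be chosen. Otherwise, by the display rule, the relevant part is everything or nothing. -/
theorem valuation_oneWay (hd : MonotoneSubmodularDemand φ) :
    Valuation φ K (oneWay φ K) (demand φ) where
  empty b := (demand_empty φ b).ge
  mono b := (hd b).1
  submod b A B hAB hB e he := by
    -- For `e ∈ B` the left side is zero and monotonicity suffices; the assumed submodularity only
    -- covers `e ∉ B`.
    by_cases heB : e ∈ B
    · rw [Finset.insert_eq_of_mem heB, sub_self, sub_nonneg]
      exact (hd b).1 _ _ (Finset.subset_insert _ _)
        (Finset.insert_subset he (hAB.trans hB))
    · exact (hd b).2 A B hAB hB e he heB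
  respond h b S _ hS hD := by
    rw [sum_ite_mul_eq_filter S (fun c => h c = some (some b)) fun _ => 1]
    simp only [one_mul]
    have hsub : S.filter (fun c => h c = some (some b)) ⊆ backlog h b := fun c hc => by
      rw [Finset.mem_filter] at hc
      exact mem_backlog.2 ⟨hS hc.1, hc.2⟩
    have hmono := (hd b).1 _ _ hsub (backlog_subset h b)
    refine le_trans ?_ hmono
    rcases hD.2 with hw | hn | hb
    · exact Finset.sum_le_sum fun c hc => (hw _ S (Finset.filter_subset _ _) hS).2 c hc
    · rw [Finset.filter_false_of_mem fun c hc => by simp [hn c hc], demand_empty]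
      simp
    · rw [Finset.filter_true_of_mem hb, demand]
  initiate h a S hS hD θ hθ := by
    rcases hD.2 with hw | hn | hb
    · refine ⟨S.filter fun c => h c = none, (Finset.filter_subset _ _).trans hS, hD.1, ?_⟩
      rw [sum_ite_mul_eq_filter S (fun c => h c = none) θ]
      refine Finset.sum_le_sum fun c hc => ?_
      exact mul_le_mul_of_nonneg_left ((hw _ S (Finset.filter_subset _ _) hS).2 c hc)
        (hθ c (hS (Finset.mem_filter.1 hc).1))
    · refine ⟨S, hS, by simpa [Finset.filter_true_of_mem hn] using hD.1, ?_⟩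
      rw [sum_ite_mul_eq_filter S (fun c => h c = none) θ, Finset.filter_true_of_mem hn]
    · refine ⟨∅, by simp, by simp, ?_⟩
      rw [sum_ite_mul_eq_filter S (fun c => h c = none) θ,
        Finset.filter_false_of_mem fun c hc => by simp [hb c hc]]
      simp

theorem oneWay_of_unprocessed (h : History n m) (a : Agent n m) (S : Finset (Agent n m))
    (hc : S.card ≤ K a) (hn : ∀ b ∈ S, h b = none) : oneWay φ K h a S :=
  ⟨by rwa [Finset.filter_true_of_mem hn], .inr (.inl hn)⟩

theorem oneWay_backlog (h : History n m) (b : Agent n m) : oneWay φ K h b (backlog h b) := by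
  have hb : ∀ c ∈ backlog h b, h c = some (some b) := fun c hc => (mem_backlog.1 hc).2
  exact ⟨by rw [Finset.filter_false_of_mem fun c hc => by simp [hb c hc]]; simp, .inr (.inr hb)⟩

/-- The number of the row of the array `2` that holds the backlog of the current responder. -/
def backlogRow : NExp := .add (nvar 5) (.lit 1)

/-- Query how likely the current responder declines its backlog. -/
def declineQuery (side y : ℕ) : Cmd :=
  .prob (.lit (1 - side)) (nvar 5) 2 backlogRow (.lit 0) y (.lit 0) (.lit 0)

/-- Query how likely the current responder declines its backlog, without and with the current
initiator. -/
def oneWayVal (side : ℕ) : Cmd :=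
  .seq (declineQuery side 6)
    (.seq (.nset 2 backlogRow (nvar 4) (.lit 1))
      (.seq (declineQuery side 7) (.nset 2 backlogRow (nvar 4) (.lit 0))))

/-- The greedy program for the one-way constrained setting. -/
def oneWayProgram (side : ℕ) : Cmd :=
  greedyProgram side (oneWayVal side) (.sub (rvar 6) (rvar 7))
    (.best (.lit side) (nvar 4) 2 (.lit 0) 6 (.lit 0)) 6 (.lit 0) .skip 2 backlogRow

theorem Det.prob_none {O : Oracles n m} {s : Store} {side idx : NExp} {x : ℕ} {r o : NExp} {y : ℕ}
    {i j : NExp} {a : Agent n m} (ha : agentAt n m (side.eval s) (idx.eval s) = some a)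
    (ho : o.eval s = 0) : Det O (.prob side idx x r o y i j) 1 s
      (s.setReal y (i.eval s) (j.eval s) (O.prob a (readSet s a x (r.eval s)) none)) :=
  Det.of_step fun L => by simp [detStep, ha, ho]

theorem Det.best {O : Oracles n m} {s : Store} {side idx : NExp} {x : ℕ} {r : NExp} {y : ℕ}
    {i : NExp} {a : Agent n m} (ha : agentAt n m (side.eval s) (idx.eval s) = some a) :
    ∃ s', Det O (.best side idx x r y i) 1 s s' ∧ (∀ p ≤ y, Keep p s s') ∧
      readSet s' a y (i.eval s) =
        opposite a ∩ O.best a fun b => s.real x (r.eval s) (number b) := by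
  classical
  refine ⟨s.setRow y (i.eval s) fun t =>
    if ∃ b ∈ opposite a, b ∈ O.best a (fun b => s.real x (r.eval s) (number b)) ∧
      number b = t then 1 else 0, Det.of_step fun L => by simp [detStep, ha],
    fun p hp => (Keep.refl _ _).setRow hp _ _, ?_⟩
  ext c
  rw [mem_readSet, Store.nat_setRow_self, Finset.mem_inter]
  refine and_congr_right fun hc => ?_
  constructor
  · intro h
    split_ifs at h with h'
    · obtain ⟨b, hb, hbb, hbc⟩ := h'
      rw [mem_opposite] at hb hc
      rwa [← number_inj (by rw [hb, hc]) hbc]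
    · exact absurd rfl h
  · intro h
    rw [if_pos ⟨c, hc, h, rfl⟩]
    exact one_ne_zero

/-- Demand is one minus the probability of declining, so a marginal value takes two queries.
Responding needs no computation: the backlog itself is shown. -/
theorem subroutines_oneWay (hφ : IsChoiceModel φ) {reg : Regime}
    {best : Agent n m → (Agent n m → ℝ) → Finset (Agent n m)}
    (hbest : SolvesConstrainedAssortment φ K reg best) (s₀ : Store) {side : ℕ} (hs : side ≤ 1)
    (hside : ∀ a : Agent n m, sideOf a = side → reg.Initiates a) :
    Subroutines ⟨φ, best⟩ φ K (oneWay φ K) (demand φ) s₀ side (oneWayVal side)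
      (.sub (rvar 6) (rvar 7)) (.best (.lit side) (nvar 4) 2 (.lit 0) 6 (.lit 0)) 6 (.lit 0) .skip
      2 backlogRow 7 1 1 where
  val h s a b ha hb han hT h4 h5 := by
    have hagent : agentAt n m (1 - side) (number b) = some b := by rw [← hb, agentAt_number]
    have hab : a ∈ opposite b := mem_opposite.2 (by omega)
    have hB := hT.2 b hb
    -- For the second query `a` is entered temporarily into the backlog row. Since the cell was `0`,
    -- resetting it to `0` restores the array.
    have hz : s.nat 2 (number b + 1) (number a) = 0 := by
      have : a ∉ readSet s b 2 (number b + 1) := by rw [hB]; simp [mem_backlog, han]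
      simpa [mem_readSet, hab] using this
    set s₁ := s.setReal 6 0 0 (φ b (backlog h b) none) with hs₁
    set s₂ := s₁.setNat 2 (number b + 1) (number a) 1 with hs₂
    have h5₂ : s₂.nat 5 0 0 = number b := by rw [hs₂, Store.nat_setNat_ne _ (by omega)]; exact h5
    have h4₂ : s₂.nat 4 0 0 = number a := by rw [hs₂, Store.nat_setNat_ne _ (by omega)]; exact h4
    have hread : readSet s₂ b 2 (number b + 1) = insert a (backlog h b) := by
      rw [← hB]
      ext c
      rw [Finset.mem_insert, mem_readSet, mem_readSet, hs₂, Store.nat_setNat]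
      by_cases hc : c ∈ opposite b
      · by_cases hca : c = a
        · simp [hca, hab]
        · have : number c ≠ number a := fun h' => hca (number_inj
            (by rw [mem_opposite] at hc hab; omega) h')
          simp [hca, this, hs₁]
      · have : c ≠ a := by rintro rfl; exact hc hab
        simp [hc, this]
    have d₁ : Det (⟨φ, best⟩ : Oracles n m) (declineQuery side 6) 1 s s₁ := by
      have := Det.prob_none (O := ⟨φ, best⟩) (s := s) (side := .lit (1 - side)) (idx := nvar 5)
        (x := 2) (r := backlogRow) (o := .lit 0) (y := 6) (i := .lit 0) (j := .lit 0) (a := b)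
        (by simpa [h5] using hagent) rfl
      simpa [declineQuery, backlogRow, h5, hB] using this
    have d₂ : Det (⟨φ, best⟩ : Oracles n m) (.nset 2 backlogRow (nvar 4) (.lit 1)) 1 s₁ s₂ := by
      have := Det.nset (O := (⟨φ, best⟩ : Oracles n m)) (s := s₁) 2 backlogRow (nvar 4) (.lit 1)
      simpa [backlogRow, hs₁, h5, h4] using this
    have d₃ : Det (⟨φ, best⟩ : Oracles n m) (declineQuery side 7) 1 s₂
        (s₂.setReal 7 0 0 (φ b (insert a (backlog h b)) none)) := by
      have := Det.prob_none (O := ⟨φ, best⟩) (s := s₂) (side := .lit (1 - side)) (idx := nvar 5)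
        (x := 2) (r := backlogRow) (o := .lit 0) (y := 7) (i := .lit 0) (j := .lit 0) (a := b)
        (by simpa [h5₂] using hagent) rfl
      simpa [declineQuery, backlogRow, h5₂, hread] using this
    refine ⟨_, d₁.seq (d₂.seq (d₃.seq (Det.nset _ _ _ _))), ?_, ?_⟩
    · constructor
      · intro x hx
        funext i j
        simp only [backlogRow, NExp.eval_add, NExp.eval_nvar, NExp.eval_lit, Store.nat_setReal,
          h5₂, h4₂]
        rw [Store.nat_setNat, Store.nat_setReal, hs₂, Store.nat_setNat]
        split_ifs with h'
        · rw [h'.1, h'.2.1, h'.2.2, hz]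
        · rfl
      · intro x hx
        rw [Store.real_setNat, Store.real_setReal_ne _ (by omega), hs₂, Store.real_setNat, hs₁,
          Store.real_setReal_ne _ (by omega)]
    · have e6 : s₂.real 6 0 0 = φ b (backlog h b) none := by simp [hs₂, hs₁]
      rw [hφ.demand_eq (backlog_subset h b),
        hφ.demand_eq (Finset.insert_subset hab (backlog_subset h b))]
      simp only [RExp.eval_sub, RExp.eval_rvar, Store.real_setNat, Store.real_setReal_self]
      rw [Store.real_setReal_ne _ (by omega), e6]
      ring
  select s a ha hk h4 hθ := by
    have hagent : agentAt n m side (number a) = some a := by rw [← ha, agentAt_number]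
    obtain ⟨s', hdet, hkeep, hread⟩ := Det.best (O := ⟨φ, best⟩) (s := s) (side := .lit side)
      (idx := nvar 4) (x := 2) (r := .lit 0) (y := 6) (i := .lit 0) (a := a)
      (by simpa [h4] using hagent)
    obtain ⟨hsub, hcard, hopt⟩ := hbest a (hside a ha) (fun b => s.real 2 0 (number b)) hθ
    simp only [NExp.eval_lit] at hread
    rw [Finset.inter_eq_right.2 hsub] at hread
    refine ⟨s', hdet, hkeep 6 le_rfl, ?_, ?_⟩
    · rw [NExp.eval_lit, hread]; exact hcard
    · rw [NExp.eval_lit, hread]; exact hopt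
  respond h s b hb hT h5 := by
    refine ⟨s, Det.skip, Keep.refl _ _, ?_⟩
    have : backlogRow.eval s = number b + 1 := by simp [backlogRow, h5]
    rw [this, hT.2 b hb]
    refine ⟨oneWay_backlog h b, Finset.sum_le_sum fun c hc => ?_⟩
    rw [if_pos (mem_backlog.1 hc).2, one_mul]

end

theorem exists_oneWayProgram (reg : Regime) : ∃ (P : Cmd) (q : Polynomial ℕ),
    ∀ (n m : ℕ) (K : Agent n m → ℕ) (φ : Choice n m)
      (best : Agent n m → (Agent n m → ℝ) → Finset (Agent n m)),
      (∀ a, 0 < K a) → IsChoiceModel φ → MonotoneSubmodularDemand φ →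
      SolvesConstrainedAssortment φ K reg best →
      ∃ π : Policy n m,
        Realizes ⟨φ, best⟩ (q.eval (n + m)) [P] (inputWithoutWeights K) π ∧
        IsApprox φ (oneWay φ K) reg reg.factor π := by
  refine ⟨regimeProgram oneWayProgram reg,
    .X * (.X * 12 + 12) + (.X * 6 + 10) + 3, fun n m K φ best _ hφ hd hbest => ?_⟩
  have hq : (.X * (.X * 12 + 12) + (.X * 6 + 10) + 3 : Polynomial ℕ).eval (n + m) =
      greedyTime (n + m) 7 1 1 + 3 := by
    simp [greedyTime]
  rw [hq]
  refine regimeProgram_isApprox reg hφ (valuation_oneWay hd)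
    (by simp [inputWithoutWeights, input]) ?_
  intro side hs hside reg' hreg' s hk h2
  exact (subroutines_oneWay hφ hbest (inputWithoutWeights K) hs hside).greedyProgram hφ
    (valuation_oneWay hd) (fun h a S _ hc hn => oneWay_of_unprocessed h a S hc hn) hs
    (fun i hi => input_count K _ hi) hreg' hk h2

/-! ### Selecting the first `K` elements -/

section top
variable {ι κ : Type*} [LinearOrder κ] (key : ι → κ) (X : Finset ι)
  (p : ι → Prop) [DecidablePred p] (K : ℕ)

/-- The elements of `X` with the property `p` that have less than `K` predecessors in `X`. -/
def firstElements : Finset ι :=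
  X.filter fun d => p d ∧ (X.filter fun e => key e < key d).card < K

variable {key X p K}

/-- All other selected elements precede the last selected one, which has fewer than `K`
predecessors. -/
theorem card_firstElements_le [DecidableEq ι] (hkey : Function.Injective key) :
    (firstElements key X p K).card ≤ K := by
  rcases (firstElements key X p K).eq_empty_or_nonempty with h | h
  · simp [h]
  obtain ⟨t, ht, hmax⟩ := Finset.exists_max_image _ key h
  have hsub : (firstElements key X p K).erase t ⊆ X.filter fun e => key e < key t := by
    intro e he
    rw [Finset.mem_erase] at he
    exact Finset.mem_filter.2 ⟨(Finset.mem_filter.1 he.2).1,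
      lt_of_le_of_ne (hmax e he.2) fun h' => he.1 (hkey h')⟩
  have h1 := Finset.card_le_card hsub
  have h2 := (Finset.mem_filter.1 ht).2.2
  rw [Finset.card_erase_of_mem ht] at h1
  omega

/-- Exchange argument. If no element with `p` is missing from `T`, then `S \ T` contributes nothing
positive. Otherwise let `d₀` be the first missing one: its predecessors fill `T` up to `K` elements,
and the value of `d₀` separates those of `S \ T` from those of `T \ S`. The order and `p` may come
from other data than `v`, as is needed for comparing two multipliers. -/
theorem sum_le_sum_firstElements [DecidableEq ι] {v : ι → ℝ}
    (hv : ∀ d ∈ X, ∀ e ∈ X, key e < key d → p d → p e ∧ v d ≤ v e)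
    (hp : ∀ d ∈ X, p d → 0 ≤ v d) (hn : ∀ d ∈ X, ¬ p d → v d ≤ 0)
    (hinj : Function.Injective key) {S : Finset ι} (hS : S ⊆ X) (hK : S.card ≤ K) :
    ∑ d ∈ S, v d ≤ ∑ d ∈ firstElements key X p K, v d := by
  set T := firstElements key X p K with hT
  have hTX : T ⊆ X := Finset.filter_subset _ _
  have hTp : ∀ d ∈ T, p d := fun d hd => (Finset.mem_filter.1 hd).2.1
  suffices h : ∑ d ∈ S \ T, v d ≤ ∑ d ∈ T \ S, v d by
    rw [← Finset.sum_inter_add_sum_sdiff S T, ← Finset.sum_inter_add_sum_sdiff T S,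
      Finset.inter_comm T S]
    linarith
  have hnonneg : 0 ≤ ∑ d ∈ T \ S, v d := Finset.sum_nonneg fun d hd =>
    hp d (hTX (Finset.mem_sdiff.1 hd).1) (hTp d (Finset.mem_sdiff.1 hd).1)
  rcases (X.filter fun d => p d ∧ d ∉ T).eq_empty_or_nonempty with h | h
  · refine le_trans (Finset.sum_nonpos fun d hd => ?_) hnonneg
    rw [Finset.mem_sdiff] at hd
    refine hn d (hS hd.1) fun hpd => ?_
    have : d ∈ X.filter fun d => p d ∧ d ∉ T := Finset.mem_filter.2 ⟨hS hd.1, hpd, hd.2⟩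
    simp [h] at this
  obtain ⟨d₀, hd₀, hmin⟩ := Finset.exists_min_image _ key h
  obtain ⟨hd₀X, hd₀p, hd₀T⟩ := Finset.mem_filter.1 hd₀
  have hrank : K ≤ (X.filter fun e => key e < key d₀).card := by
    by_contra hlt
    exact hd₀T (Finset.mem_filter.2 ⟨hd₀X, hd₀p, by omega⟩)
  have hbefore : (X.filter fun e => key e < key d₀) ⊆ T := by
    intro e he
    obtain ⟨heX, hlt⟩ := Finset.mem_filter.1 he
    by_contra heT
    exact absurd (hmin e (Finset.mem_filter.2 ⟨heX, (hv d₀ hd₀X e heX hlt hd₀p).1, heT⟩))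
      (not_le.2 hlt)
  have hKT : K ≤ T.card := hrank.trans (Finset.card_le_card hbefore)
  -- No `t ∈ T` comes after `d₀`, as it would inherit at least `K` predecessors from it.
  have hτ : ∀ t ∈ T, v d₀ ≤ v t := by
    intro t ht
    obtain ⟨htX, htp, htK⟩ := Finset.mem_filter.1 ht
    rcases lt_trichotomy (key t) (key d₀) with h' | h' | h'
    · exact (hv d₀ hd₀X t htX h' hd₀p).2
    · rw [hinj h']
    · have := Finset.card_le_card (Finset.monotone_filter_right X
        (fun e _ (he : key e < key d₀) => he.trans h'))
      omega
  have h0 := hp d₀ hd₀X hd₀p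
  have hτ' : ∀ d ∈ S \ T, v d ≤ v d₀ := by
    intro d hd
    rw [Finset.mem_sdiff] at hd
    by_cases hpd : p d
    · rcases (hmin d (Finset.mem_filter.2 ⟨hS hd.1, hpd, hd.2⟩)).lt_or_eq with h' | h'
      · exact (hv d (hS hd.1) d₀ hd₀X h' hpd).2
      · rw [hinj h']
    · exact (hn d (hS hd.1) hpd).trans h0
  have hcard : (S \ T).card ≤ (T \ S).card := by
    have h1 := Finset.card_sdiff_add_card_inter S T
    have h2 := Finset.card_sdiff_add_card_inter T S
    rw [Finset.inter_comm T S] at h2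
    omega
  calc ∑ d ∈ S \ T, v d ≤ (S \ T).card * v d₀ := by
        simpa using Finset.sum_le_card_nsmul _ _ _ hτ'
    _ ≤ (T \ S).card * v d₀ := by gcongr
    _ ≤ ∑ d ∈ T \ S, v d := by
        simpa using Finset.card_nsmul_le_sum _ _ _ fun t ht => hτ t (Finset.mem_sdiff.1 ht).1

end top

/-! ### Cardinality constrained assortment optimization under the multinomial logit model -/

section assortment
variable (M K : ℕ) (U Θ : ℕ → ℝ)

/-- The expected value of an assortment. -/
def revenue (S : Finset ℕ) : ℝ := (∑ d ∈ S, U d * Θ d) / (1 + ∑ d ∈ S, U d)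

/-- The contribution of `d` for the Lagrange multiplier `l`. -/
def reduced (l : ℝ) (d : ℕ) : ℝ := U d * (Θ d - l)

/-- The order of decreasing reduced values just after `l`. -/
def Before (l : ℝ) (e d : ℕ) : Prop :=
  reduced U Θ l d < reduced U Θ l e ∨ reduced U Θ l e = reduced U Θ l d ∧
    (U e < U d ∨ U e = U d ∧ e < d)

/-- A linear order that realizes `Before`. -/
def priority (l : ℝ) (d : ℕ) : ℝ ×ₗ ℝ ×ₗ ℕ := toLex (-reduced U Θ l d, toLex (U d, d))

theorem priority_lt_iff (l : ℝ) (e d : ℕ) :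
    priority U Θ l e < priority U Θ l d ↔ Before U Θ l e d := by
  simp [priority, Before, Prod.Lex.toLex_lt_toLex]

theorem priority_injective (l : ℝ) : Function.Injective (priority U Θ l) := by
  intro d e h
  simp only [priority, EmbeddingLike.apply_eq_iff_eq, Prod.mk.injEq] at h
  exact h.2.2

open Classical in
/-- The first `K` elements with positive reduced value. -/
def topSet (l : ℝ) : Finset ℕ :=
  firstElements (priority U Θ l) (Finset.range M) (fun d => 0 < reduced U Θ l d) K

/-- The multiplier for which `b` and `c` have the same reduced value. -/
def crossing (b c : ℕ) : ℝ := (U b * Θ b - U c * Θ c) / (U b - U c)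

variable {M K U Θ}

open Classical in
theorem mem_topSet {l : ℝ} {d : ℕ} : d ∈ topSet M K U Θ l ↔ d < M ∧ 0 < reduced U Θ l d ∧
    ((Finset.range M).filter fun e => Before U Θ l e d).card < K := by
  simp [topSet, firstElements, priority_lt_iff]

theorem topSet_subset (l : ℝ) : topSet M K U Θ l ⊆ Finset.range M := Finset.filter_subset _ _

theorem card_topSet_le (l : ℝ) : (topSet M K U Θ l).card ≤ K :=
  card_firstElements_le (priority_injective U Θ l)

theorem revenue_nonneg {S : Finset ℕ} (hU : ∀ d, 0 ≤ U d) (hΘ : ∀ d ∈ S, 0 ≤ Θ d) :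
    0 ≤ revenue U Θ S :=
  div_nonneg (Finset.sum_nonneg fun d hd => mul_nonneg (hU d) (hΘ d hd))
    (add_nonneg zero_le_one (Finset.sum_nonneg fun d _ => hU d))

/-- Multiply by the positive denominator: comparing a ratio with `l` becomes a comparison of an
additive objective with `l`. -/
theorem le_revenue_iff {S : Finset ℕ} (hU : ∀ d, 0 ≤ U d) {l : ℝ} :
    l ≤ revenue U Θ S ↔ l ≤ ∑ d ∈ S, reduced U Θ l d := by
  have hpos : 0 < 1 + ∑ d ∈ S, U d :=
    add_pos_of_pos_of_nonneg zero_lt_one (Finset.sum_nonneg fun d _ => hU d)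
  rw [revenue, le_div_iff₀ hpos]
  simp only [reduced, mul_sub, Finset.sum_sub_distrib, ← Finset.sum_mul]
  constructor <;> intro h <;> linarith

/-- If there is no crossing between `l` and `l'`, then the order at `l` is respected at `l'`. -/
theorem reduced_le_of_no_crossing {l l' : ℝ} {d e : ℕ} (hl : l ≤ l')
    (hcross : crossing U Θ e d ≤ l' → crossing U Θ e d ≤ l)
    (h : reduced U Θ l d ≤ reduced U Θ l e)
    (htie : reduced U Θ l d = reduced U Θ l e → U e ≤ U d) :
    reduced U Θ l' d ≤ reduced U Θ l' e := by
  by_contra! hlt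
  unfold reduced at *
  -- Reduced values are affine in the multiplier with slopes `-U`. To fall behind, `e` must be
  -- steeper, so the lines cross no later than `l'`, hence no later than `l`. Then they are tied at
  -- `l`, which contradicts the tie rule.
  have hU : U d < U e := by
    by_contra! hle
    nlinarith
  have hne : 0 < U e - U d := by linarith
  have h1 : crossing U Θ e d ≤ l' := by
    rw [crossing, div_le_iff₀ hne]
    nlinarith
  have h2 := hcross h1
  rw [crossing, div_le_iff₀ hne] at h2
  have h3 : U d * (Θ d - l) = U e * (Θ e - l) := by nlinarith
  linarith [htie h3]

/-- Let `l'` be the optimal revenue and `l` the largest crossing up to `l'`. The order just after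
`l` is still correct at `l'`, so the top set for `l` maximizes the additive objective at `l'`. The
item `M` of weight zero is a phantom whose line is constantly zero; crossings with it are the sign
changes of reduced values. -/
theorem exists_crossing_optimal (hU : ∀ d, 0 ≤ U d) (hΘ : ∀ d < M, 0 ≤ Θ d) (hM : U M = 0) :
    ∃ b ≤ M, ∃ c ≤ M, ∀ S ⊆ Finset.range M, S.card ≤ K →
      revenue U Θ S ≤ revenue U Θ (topSet M K U Θ (crossing U Θ b c)) := by
  classical
  obtain ⟨S₀, hS₀, hmax⟩ := Finset.exists_max_image
    ((Finset.range M).powerset.filter fun S => S.card ≤ K) (revenue U Θ) ⟨∅, by simp⟩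
  rw [Finset.mem_filter, Finset.mem_powerset] at hS₀
  set l' := revenue U Θ S₀ with hl'
  have hl'0 : 0 ≤ l' := revenue_nonneg hU fun d hd => hΘ d (by simpa using hS₀.1 hd)
  -- The pair `(0, 0)` is a candidate: its crossing is `0 / 0 = 0`, and `0 ≤ l'`.
  obtain ⟨⟨b, c⟩, hbc, hbcmax⟩ := Finset.exists_max_image
    ((Finset.range (M + 1) ×ˢ Finset.range (M + 1)).filter fun q => crossing U Θ q.1 q.2 ≤ l')
    (fun q => crossing U Θ q.1 q.2) ⟨(0, 0),
      Finset.mem_filter.2 ⟨by simp, by simpa [crossing] using hl'0⟩⟩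
  simp only [Finset.mem_filter, Finset.mem_product, Finset.mem_range] at hbc hbcmax
  refine ⟨b, by omega, c, by omega, fun S hS hc => ?_⟩
  refine (hmax S (by simp [hS, hc])).trans ?_
  set l := crossing U Θ b c
  have hcross : ∀ d ≤ M, ∀ e ≤ M, crossing U Θ e d ≤ l' → crossing U Θ e d ≤ l :=
    fun d hd e he h => hbcmax (e, d) ⟨⟨by omega, by omega⟩, h⟩
  rw [le_revenue_iff hU]
  refine le_trans ((le_revenue_iff hU).1 hl'.le) ?_
  refine sum_le_sum_firstElements (p := fun d => 0 < reduced U Θ l d) ?_ ?_ ?_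
    (priority_injective U Θ l) hS₀.1 hS₀.2
  · intro d hd e he hlt hpd
    rw [Finset.mem_range] at hd he
    rw [priority_lt_iff] at hlt
    have hle : reduced U Θ l d ≤ reduced U Θ l e := by
      rcases hlt with h | h
      exacts [h.le, h.1.ge]
    refine ⟨hpd.trans_le hle, reduced_le_of_no_crossing hbc.2
      (hcross d hd.le e he.le) hle fun heq => ?_⟩
    rcases hlt with h | ⟨_, h | h⟩
    · exact absurd heq h.ne
    · exact h.le
    · exact h.1.le
  · intro d hd hpd
    rw [Finset.mem_range] at hd
    -- A reduced value that is positive at `l` stays nonnegative at `l'`, since it does not cross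
    -- the phantom line in between.
    have h0 : ∀ x, reduced U Θ x M = 0 := fun x => by simp [reduced, hM]
    have := reduced_le_of_no_crossing hbc.2 (hcross M le_rfl d hd.le)
      (by rw [h0]; exact hpd.le) fun h => by rw [h0] at h; exact absurd h hpd.ne
    rwa [h0] at this
  · intro d _ hpd
    have : reduced U Θ l' d ≤ reduced U Θ l d :=
      mul_le_mul_of_nonneg_left (by linarith [hbc.2]) (hU d)
    linarith

end assortment

/-! ### Valuations in the two-way constrained setting -/

section topWeight
variable {ι : Type*} (K : ℕ) (w : ι → ℝ)

/-- The largest weight of a subset with at most `K` elements. -/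
def topWeight (B : Finset ι) : ℝ :=
  (B.powerset.filter fun S => S.card ≤ K).sup' ⟨∅, by simp⟩ fun S => ∑ c ∈ S, w c

variable {K w}

theorem le_topWeight {B S : Finset ι} (hS : S ⊆ B) (hK : S.card ≤ K) :
    ∑ c ∈ S, w c ≤ topWeight K w B :=
  Finset.le_sup' (fun S => ∑ c ∈ S, w c) (by simp [hS, hK])

theorem exists_topWeight (K : ℕ) (w : ι → ℝ) (B : Finset ι) :
    ∃ S ⊆ B, S.card ≤ K ∧ topWeight K w B = ∑ c ∈ S, w c := by
  obtain ⟨S, hS, h⟩ := Finset.exists_mem_eq_sup'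
    (s := B.powerset.filter fun S => S.card ≤ K) ⟨∅, by simp⟩ fun S => ∑ c ∈ S, w c
  rw [Finset.mem_filter, Finset.mem_powerset] at hS
  exact ⟨S, hS.1, hS.2, h⟩

theorem topWeight_nonneg (K : ℕ) (w : ι → ℝ) (B : Finset ι) : 0 ≤ topWeight K w B := by
  simpa using le_topWeight (K := K) (w := w) (Finset.empty_subset B) (by simp)

theorem topWeight_mono {A B : Finset ι} (h : A ⊆ B) : topWeight K w A ≤ topWeight K w B := by
  obtain ⟨S, hS, hK, hw⟩ := exists_topWeight K w A
  rw [hw]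
  exact le_topWeight (hS.trans h) hK

/-- Exchange between optimal sets `R` for `insert e B` and `S` for `A`: move `e` from `R` to `S`,
and if `S` was full, move some `x` of `S` to `R` in return. The total weight is preserved. -/
theorem topWeight_submod [DecidableEq ι] {A B : Finset ι} (h : A ⊆ B) (e : ι) :
    topWeight K w (insert e B) + topWeight K w A ≤
      topWeight K w (insert e A) + topWeight K w B := by
  obtain ⟨S, hS, hSK, hSw⟩ := exists_topWeight K w A
  obtain ⟨R, hR, hRK, hRw⟩ := exists_topWeight K w (insert e B)
  by_cases heB : e ∈ B
  · rw [Finset.insert_eq_of_mem heB]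
    linarith [topWeight_mono (K := K) (w := w) (Finset.subset_insert e A)]
  have heS : e ∉ S := fun h' => heB (h (hS h'))
  by_cases heR : e ∈ R
  · have hR' : R.erase e ⊆ B := fun x hx => by
      rw [Finset.mem_erase] at hx
      exact (Finset.mem_insert.1 (hR hx.2)).resolve_left hx.1
    have hsumR := Finset.add_sum_erase R w heR
    have hcardR := Finset.card_erase_of_mem heR
    have hposR : 0 < R.card := Finset.card_pos.2 ⟨e, heR⟩
    by_cases hlt : S.card < K
    · have h1 := le_topWeight (K := K) (w := w) (Finset.insert_subset_insert e hS)
        (by rw [Finset.card_insert_of_notMem heS]; omega)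
      have h2 := le_topWeight (K := K) (w := w) hR' (by omega)
      rw [Finset.sum_insert heS] at h1
      linarith
    -- `S` has `K` elements and `R.erase e` has fewer.
    · obtain ⟨x, hxS, hxR⟩ : ∃ x ∈ S, x ∉ R.erase e := by
        by_contra! hsub
        have := Finset.card_le_card (show S ⊆ R.erase e from hsub)
        omega
      have hsumS := Finset.add_sum_erase S w hxS
      have hcardS := Finset.card_erase_of_mem hxS
      have heS' : e ∉ S.erase x := fun h' => heS (Finset.mem_of_mem_erase h')
      have h1 := le_topWeight (K := K) (w := w)
        (Finset.insert_subset_insert e ((Finset.erase_subset x S).trans hS))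
        (by rw [Finset.card_insert_of_notMem heS']; omega)
      have h2 := le_topWeight (K := K) (w := w) (Finset.insert_subset (h (hS hxS)) hR')
        (by rw [Finset.card_insert_of_notMem hxR]; omega)
      rw [Finset.sum_insert heS'] at h1
      rw [Finset.sum_insert hxR] at h2
      linarith
  · have h1 := le_topWeight (K := K) (w := w) (fun x hx =>
      (Finset.mem_insert.1 (hR hx)).resolve_left (by rintro rfl; exact heR hx) : R ⊆ B) hRK
    linarith [topWeight_mono (K := K) (w := w) (Finset.subset_insert e A)]

end topWeight

section twoWay
variable {u : Agent n m → Agent n m → ℝ} {K : Agent n m → ℕ}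

theorem div_one_add_mono {x y : ℝ} (hx : 0 ≤ x) (h : x ≤ y) : x / (1 + x) ≤ y / (1 + y) := by
  rw [div_le_div_iff₀ (by linarith) (by linarith)]
  nlinarith

/-- Concavity and monotonicity of `x / (1 + x)`: the step from `b` to `b'` is no longer than that
from `a` to `a'` and starts further right. -/
theorem div_one_add_sub_le {a a' b b' : ℝ} (ha : 0 ≤ a) (hab : a ≤ b) (hb : b ≤ b')
    (h : b' + a ≤ a' + b) :
    b' / (1 + b') - b / (1 + b) ≤ a' / (1 + a') - a / (1 + a) := by
  -- Shorten the step from `a` to the length `b' - b`; then the two differences have the same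
  -- numerator.
  have h1 : (b' - b + a) / (1 + (b' - b + a)) ≤ a' / (1 + a') :=
    div_one_add_mono (by linarith) (by linarith)
  refine le_trans ?_ (sub_le_sub_right h1 _)
  rw [div_sub_div _ _ (by linarith) (by linarith), div_sub_div _ _ (by linarith) (by linarith)]
  have e1 : b' * (1 + b) - (1 + b') * b = b' - b := by ring
  have e2 : (b' - b + a) * (1 + a) - (1 + (b' - b + a)) * a = b' - b := by ring
  rw [e1, e2]
  refine div_le_div_of_nonneg_left (by linarith) (by nlinarith) ?_
  exact mul_le_mul (by linarith) (by linarith) (by linarith) (by linarith)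

theorem mnl_some {a c : Agent n m} {S : Finset (Agent n m)} (hc : c ∈ S) :
    mnl u a S (some c) = u a c / (1 + ∑ d ∈ S, u a d) := by
  simp [mnl, hc]

theorem sum_mul_mnl (a : Agent n m) (S : Finset (Agent n m)) (θ : Agent n m → ℝ) :
    ∑ c ∈ S, θ c * mnl u a S (some c) = (∑ c ∈ S, u a c * θ c) / (1 + ∑ c ∈ S, u a c) := by
  rw [Finset.sum_div]
  refine Finset.sum_congr rfl fun c hc => ?_
  rw [mnl_some hc]
  ring

theorem isChoiceModel_mnl (hu : ∀ a b, 0 ≤ u a b) : IsChoiceModel (mnl u) := by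
  intro a S _
  have h0 : 0 ≤ ∑ c ∈ S, u a c := Finset.sum_nonneg fun c _ => hu a c
  refine ⟨fun o => ?_, ?_, fun b hb => by simp [mnl, hb]⟩
  · cases o with
    | none => simp only [mnl]; positivity
    | some b =>
      simp only [mnl]
      split_ifs
      · exact div_nonneg (hu a b) (by linarith)
      · exact le_rfl
  · rw [Fintype.sum_option]
    simp only [mnl]
    rw [← Finset.sum_filter]
    simp only [Finset.filter_mem_eq_inter, Finset.univ_inter]
    rw [← Finset.sum_div, ← add_div, div_self (by linarith)]

/-- Values can only increase if the agents without value are not shown. -/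
theorem sum_ite_mul_mnl_le (hu : ∀ a b, 0 ≤ u a b) (a : Agent n m) (S : Finset (Agent n m))
    (q : Agent n m → Prop) [DecidablePred q] (θ : Agent n m → ℝ) (hθ : ∀ c ∈ S, 0 ≤ θ c) :
    ∑ c ∈ S, (if q c then θ c else 0) * mnl u a S (some c) ≤
      ∑ c ∈ S.filter q, θ c * mnl u a (S.filter q) (some c) := by
  rw [sum_ite_mul_eq_filter S q θ]
  refine Finset.sum_le_sum fun c hc => mul_le_mul_of_nonneg_left ?_
    (hθ c (Finset.mem_filter.1 hc).1)
  rw [mnl_some hc, mnl_some (Finset.mem_filter.1 hc).1]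
  refine div_le_div_of_nonneg_left (hu a c) ?_ (by
    gcongr 1 + ?_
    exact Finset.sum_le_sum_of_subset_of_nonneg (Finset.filter_subset _ _) fun d _ _ => hu a d)
  have : 0 ≤ ∑ c ∈ S.filter q, u a c := Finset.sum_nonneg fun c _ => hu a c
  linarith

/-- The largest probability with which `b` chooses from the backlog `B`. -/
def mnlValue (u : Agent n m → Agent n m → ℝ) (K : Agent n m → ℕ) (b : Agent n m)
    (B : Finset (Agent n m)) : ℝ :=
  topWeight (K b) (u b) B / (1 + topWeight (K b) (u b) B)

theorem sum_indicator_mul_mnl_le (hu : ∀ a b, 0 ≤ u a b) (b : Agent n m)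
    {S B : Finset (Agent n m)} (q : Agent n m → Prop) [DecidablePred q]
    (hq : ∀ c ∈ S, q c → c ∈ B) (hK : S.card ≤ K b) :
    ∑ c ∈ S, (if q c then 1 else 0) * mnl u b S (some c) ≤ mnlValue u K b B := by
  refine (sum_ite_mul_mnl_le hu b S q (fun _ => 1) fun _ _ => zero_le_one).trans ?_
  rw [sum_mul_mnl]
  simp only [mul_one]
  refine div_one_add_mono (Finset.sum_nonneg fun c _ => hu b c) (le_topWeight ?_ ?_)
  · intro c hc
    rw [Finset.mem_filter] at hc
    exact hq c hc.1 hc.2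
  · exact (Finset.card_filter_le _ _).trans hK

theorem mnlValue_le_of_optimal {b : Agent n m}
    {S B : Finset (Agent n m)} (hB : B ⊆ opposite b) {θ : Agent n m → ℝ}
    (hθ : ∀ c ∈ B, θ c = 1)
    (hopt : ∀ S' ⊆ opposite b, S'.card ≤ K b →
      ∑ c ∈ S', θ c * mnl u b S' (some c) ≤ ∑ c ∈ S, θ c * mnl u b S (some c)) :
    mnlValue u K b B ≤ ∑ c ∈ S, θ c * mnl u b S (some c) := by
  obtain ⟨R, hR, hRK, hRw⟩ := exists_topWeight (K b) (u b) B
  refine le_trans ?_ (hopt R (hR.trans hB) hRK)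
  rw [sum_mul_mnl, mnlValue, hRw, Finset.sum_congr (g := fun c => u b c * θ c) rfl
    fun c hc => by rw [hθ c (hR hc), mul_one]]

/-- Submodularity passes from `topWeight` to its concave increasing transform. For MNL, hiding
worthless agents shrinks the denominator, which gives the last two properties. -/
theorem valuation_twoWay (hu : ∀ a b, 0 ≤ u a b) :
    Valuation (mnl u) K (twoWay K) (mnlValue u K) where
  empty b := div_nonneg (topWeight_nonneg _ _ _) (by linarith [topWeight_nonneg (K b) (u b) ∅])
  mono b A B hAB _ := div_one_add_mono (topWeight_nonneg _ _ _) (topWeight_mono hAB)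
  submod b A B hAB _ e _ := div_one_add_sub_le (topWeight_nonneg _ _ _) (topWeight_mono hAB)
    (topWeight_mono (Finset.subset_insert _ _)) (topWeight_submod hAB e)
  respond h b S _ hS hD := sum_indicator_mul_mnl_le hu b _
    (fun c hc hcb => mem_backlog.2 ⟨hS hc, hcb⟩) hD
  initiate h a S hS hD θ hθ := ⟨S.filter fun c => h c = none, (Finset.filter_subset _ _).trans hS,
    (Finset.card_filter_le _ _).trans hD,
    sum_ite_mul_mnl_le hu a S (fun c => h c = none) θ fun c hc => hθ c (hS hc)⟩

end twoWay

/-! ### A program for assortment optimization under the multinomial logit model -/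

section code
variable (side z y : ℕ)

/-- The weight that the agent `(side, z)` gives to the agent in the variable `k`. -/
def weightExp (k : ℕ) : RExp := .get side (nvar z) (nvar k)

/-- The value of the agent in the variable `k`. -/
def valueExp (k : ℕ) : RExp := .get y (.lit 0) (nvar k)

/-- The reduced value of the agent in the variable `k` for the multiplier in the variable `12`. -/
def reducedExp (k : ℕ) : RExp := .mul (weightExp side z k) (.sub (valueExp y k) (rvar 12))

/-- The number of agents opposite to the agents on `side`. -/
def oppositeCount : NExp := .get 0 (.lit 0) (.lit (1 - side))

/-- Disjunction. -/
def BExp.or (a b : BExp) : BExp := .not (.and (.not a) (.not b))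

/-- Does the agent in the variable `16` precede the agent in the variable `15`? -/
def beforeExp : BExp :=
  .or (.not (.rle (reducedExp side z y 16) (reducedExp side z y 15)))
    (.and (.and (.rle (reducedExp side z y 16) (reducedExp side z y 15))
        (.rle (reducedExp side z y 15) (reducedExp side z y 16)))
      (.or (.not (.rle (weightExp side z 15) (weightExp side z 16)))
        (.and (.and (.rle (weightExp side z 15) (weightExp side z 16))
          (.rle (weightExp side z 16) (weightExp side z 15)))
          (.not (.nle (nvar 15) (nvar 16))))))

/-- Count the predecessors of the agent in the variable `15`. -/
def rankLoop : Cmd :=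
  forLoop 16 (oppositeCount side)
    (.ite (beforeExp side z y) (.nset 17 (.lit 0) (.lit 0) (.add (nvar 17) (.lit 1))) .skip)

/-- Decide whether the agent in the variable `15` belongs to the assortment. -/
def insertCmd : Cmd :=
  .ite (.and (.not (.rle (reducedExp side z y 15) .zero))
      (.not (.nle (.get 1 (.lit side) (nvar z)) (nvar 17))))
    (.seq (.nset 14 (.lit 0) (nvar 15) (.lit 1))
      (.seq (.rset 14 (.lit 0) (.lit 0)
          (.add (rvar 14) (.mul (weightExp side z 15) (valueExp y 15))))
        (.rset 15 (.lit 0) (.lit 0) (.add (rvar 15) (weightExp side z 15)))))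
    (.nset 14 (.lit 0) (nvar 15) (.lit 0))

/-- Compute in row `0` of the array `14` the assortment for the multiplier in the variable `12`,
and its value as the quotient of the variables `14` and `15`. -/
def topSetCmd : Cmd :=
  .seq (.rset 14 (.lit 0) (.lit 0) .zero)
    (.seq (.rset 15 (.lit 0) (.lit 0) .one)
      (forLoop 15 (oppositeCount side)
        (.seq (.nset 17 (.lit 0) (.lit 0) (.lit 0))
          (.seq (rankLoop side z y) (insertCmd side z y)))))

/-- The value of the computed assortment. -/
def revenueExp : RExp := .div (rvar 14) (rvar 15)

/-- Try the multiplier at the crossing of the agents in the variables `11` and `13`. -/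
def tryCrossing : Cmd :=
  .seq (.rset 12 (.lit 0) (.lit 0)
      (.div (.sub (.mul (weightExp side z 11) (valueExp y 11))
          (.mul (weightExp side z 13) (valueExp y 13)))
        (.sub (weightExp side z 11) (weightExp side z 13))))
    (.seq (topSetCmd side z y)
      (.ite (.not (.rle revenueExp (rvar 10)))
        (.seq (.rset 10 (.lit 0) (.lit 0) revenueExp) (.rset 11 (.lit 0) (.lit 0) (rvar 12)))
        .skip))

/-- Compute in row `0` of the array `14` an optimal assortment for the agent `(side, z)`, with the
values in row `0` of the real array `y`. -/
def assortCmd : Cmd :=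
  .seq (.rset 10 (.lit 0) (.lit 0) .zero)
    (.seq (forLoop 11 (.add (oppositeCount side) (.lit 1))
        (forLoop 13 (.add (oppositeCount side) (.lit 1)) (tryCrossing side z y)))
      (.seq (.rset 12 (.lit 0) (.lit 0) (rvar 11)) (topSetCmd side z y)))

end code

@[simp] theorem BExp.holds_or (s : Store) (a b : BExp) :
    (BExp.or a b).Holds s ↔ a.Holds s ∨ b.Holds s := by
  simp [BExp.or, or_iff_not_and_not]

/-- The memory holds the assortment optimization problem with weights `U`, values `Θ`, `M` items and
cardinality bound `B`. -/
structure HoldsProblem (side z y M B : ℕ) (U Θ : ℕ → ℝ) (s : Store) : Prop where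
  count : s.nat 0 0 (1 - side) = M
  weight : s.real side (s.nat z 0 0) = U
  value : s.real y 0 = Θ
  bound : s.nat 1 side (s.nat z 0 0) = B

/-! ### Correctness and running time of the assortment program -/

section correct
variable {O : Oracles n m} {side z y M B : ℕ} {U Θ : ℕ → ℝ} {s s' : Store}

theorem HoldsProblem.keep (h : HoldsProblem side z y M B U Θ s) (hs : side ≤ 1) (hz : z < 10)
    (hy : y < 10) (hk : Keep 10 s s') : HoldsProblem side z y M B U Θ s' := by
  obtain ⟨h1, h2, h3, h4⟩ := h
  constructor
  · rw [hk.1 0 (by omega), h1]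
  · rw [hk.1 z hz, hk.2 side (by omega), h2]
  · rw [hk.2 y hy, h3]
  · rw [hk.1 z hz, hk.1 1 (by omega), h4]

theorem HoldsProblem.eval_weightExp (h : HoldsProblem side z y M B U Θ s) (k : ℕ) :
    (weightExp side z k).eval s = U (s.nat k 0 0) := by
  simp [weightExp, h.weight]

theorem HoldsProblem.eval_valueExp (h : HoldsProblem side z y M B U Θ s) (k : ℕ) :
    (valueExp y k).eval s = Θ (s.nat k 0 0) := by
  simp [valueExp, h.value]

theorem HoldsProblem.eval_reducedExp (h : HoldsProblem side z y M B U Θ s) (k : ℕ) :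
    (reducedExp side z y k).eval s = reduced U Θ (s.real 12 0 0) (s.nat k 0 0) := by
  simp [reducedExp, h.eval_weightExp, h.eval_valueExp, reduced]

theorem HoldsProblem.eval_oppositeCount (h : HoldsProblem side z y M B U Θ s) :
    (oppositeCount side).eval s = M := by
  simp [oppositeCount, h.count]

theorem HoldsProblem.holds_beforeExp (h : HoldsProblem side z y M B U Θ s) :
    (beforeExp side z y).Holds s ↔
      Before U Θ (s.real 12 0 0) (s.nat 16 0 0) (s.nat 15 0 0) := by
  simp only [beforeExp, BExp.holds_or, BExp.holds_not, BExp.holds_and, BExp.holds_rle,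
    BExp.holds_nle, h.eval_reducedExp, h.eval_weightExp, NExp.eval_nvar, Before, le_antisymm_iff,
    not_le]
  tauto

open Classical in
theorem HoldsProblem.rankLoop (h : HoldsProblem side z y M B U Θ s) (hs : side ≤ 1) (hz : z < 10)
    (hy : y < 10) (h17 : s.nat 17 0 0 = 0) :
    ∃ s', Det O (rankLoop side z y) (M * 5 + 3) s s' ∧ Keep 16 s s' ∧ s'.nat 17 0 0 =
      ((Finset.range M).filter fun e => Before U Θ (s.real 12 0 0) e (s.nat 15 0 0)).card := by
  refine Det.forLoop (t := 2) (fun j s₁ => Keep 16 s s₁ ∧ s₁.nat 17 0 0 =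
      ((Finset.range j).filter fun e => Before U Θ (s.real 12 0 0) e (s.nat 15 0 0)).card)
    (fun j s₁ hI => (h.keep hs hz hy (hI.1.anti (by omega))).eval_oppositeCount)
    (fun j s₁ v hI => ⟨hI.1.setNat (by omega) _ _ _,
      by rw [Store.nat_setNat_ne _ (by omega), hI.2]⟩) ?_
    ⟨Keep.refl _ _, by simpa using h17⟩
  rintro j hj s₁ ⟨hk, hc⟩ h16
  have hb := (h.keep (s' := s₁) hs hz hy (hk.anti (by omega))).holds_beforeExp
  rw [h16, hk.1 15 (by omega), hk.2 12 (by omega)] at hb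
  by_cases hbef : Before U Θ (s.real 12 0 0) j (s.nat 15 0 0)
  · refine ⟨_, Det.ite_true (hb.2 hbef) (Det.nset _ _ _ _), ?_, hk.setNat (by omega) _ _ _, ?_⟩
    · rw [Store.nat_setNat_ne _ (by omega), h16]
    · simp [hc, Finset.range_add_one, Finset.filter_insert, hbef]
  · refine ⟨_, Det.ite_false (fun h' => hbef (hb.1 h')) Det.skip, h16, hk, ?_⟩
    simp [hc, Finset.range_add_one, Finset.filter_insert, hbef]

/-- The number of steps of `topSetCmd`. -/
def topSetTime (M : ℕ) : ℕ := M * (M * 5 + 15) + 7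

theorem HoldsProblem.topSetCmd (h : HoldsProblem side z y M B U Θ s) (hs : side ≤ 1) (hz : z < 10)
    (hy : y < 10) :
    ∃ s', Det O (topSetCmd side z y) (topSetTime M) s s' ∧ Keep 14 s s' ∧
      (∀ d < M, s'.nat 14 0 d ≠ 0 ↔ d ∈ topSet M B U Θ (s.real 12 0 0)) ∧
      revenueExp.eval s' = revenue U Θ (topSet M B U Θ (s.real 12 0 0)) := by
  classical
  set T := topSet M B U Θ (s.real 12 0 0) with hT
  set s₀ := (s.setReal 14 0 0 0).setReal 15 0 0 1 with hs₀
  have hk₀ : Keep 14 s s₀ :=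
    ((Keep.refl _ _).setReal (by omega) _ _ _).setReal (by omega) _ _ _
  -- The real variables `14` and `15` accumulate the numerator and the denominator of the revenue.
  -- Each pass computes one rank in `M * 5 + 3` steps.
  obtain ⟨s', hdet, hk, hset, hnum, hden⟩ := Det.forLoop (O := O) (k := 15)
    (N := oppositeCount side) (c := .seq (.nset 17 (.lit 0) (.lit 0) (.lit 0))
      (.seq (TwoSided.rankLoop side z y) (insertCmd side z y))) (t := M * 5 + 12) (M := M)
    (s := s₀)
    (fun i s₁ => Keep 14 s s₁ ∧ (∀ d < i, s₁.nat 14 0 d ≠ 0 ↔ d ∈ T) ∧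
      s₁.real 14 0 0 = ∑ d ∈ (Finset.range i).filter (· ∈ T), U d * Θ d ∧
      s₁.real 15 0 0 = 1 + ∑ d ∈ (Finset.range i).filter (· ∈ T), U d)
    (fun i s₁ hI => (h.keep hs hz hy (hI.1.anti (by omega))).eval_oppositeCount)
    (fun i s₁ v hI => ⟨hI.1.setNat (by omega) _ _ _,
      by rw [Store.nat_setNat_ne _ (by omega)]; exact hI.2.1, hI.2.2⟩)
    (by
      rintro i hi s₁ ⟨hk₁, hset₁, hnum₁, hden₁⟩ h15
      have hk₂ : Keep 16 s₁ (s₁.setNat 17 0 0 0) := (Keep.refl _ _).setNat (by omega) _ _ _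
      have hp₂ := h.keep (s' := s₁.setNat 17 0 0 0) hs hz hy
        ((hk₁.trans (hk₂.anti (by omega))).anti (by omega))
      obtain ⟨s₃, hdet₃, hk₃, hrank⟩ := hp₂.rankLoop (O := O) hs hz hy (by simp)
      have hk₁₃ := hk₂.trans hk₃
      have hks₃ := hk₁.trans (hk₁₃.anti (by omega))
      have hp₃ := h.keep hs hz hy (hks₃.anti (q := 10) (by omega))
      have h15₃ : s₃.nat 15 0 0 = i := by rw [hk₁₃.1 15 (by omega), h15]
      have h12₃ : s₃.real 12 0 0 = s.real 12 0 0 := by rw [hks₃.2 12 (by omega)]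
      have h14₃ : s₃.nat 14 = s₁.nat 14 := hk₁₃.1 14 (by omega)
      have hnum₃ : s₃.real 14 0 0 = s₁.real 14 0 0 := by rw [hk₁₃.2 14 (by omega)]
      have hden₃ : s₃.real 15 0 0 = s₁.real 15 0 0 := by rw [hk₁₃.2 15 (by omega)]
      rw [Store.real_setNat, hk₁.2 12 (by omega), Store.nat_setNat_ne _ (by omega), h15] at hrank
      have hcond : (BExp.and (.not (.rle (reducedExp side z y 15) .zero))
          (.not (.nle (.get 1 (.lit side) (nvar z)) (nvar 17)))).Holds s₃ ↔ i ∈ T := by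
        rw [hT, mem_topSet, ← hrank]
        simp [hp₃.eval_reducedExp, h15₃, h12₃, hp₃.bound, hi]
      have hstep : ∃ s₄, Det O (insertCmd side z y) 6 s₃ s₄ ∧ Keep 14 s₃ s₄ ∧ s₄.nat 15 0 0 = i ∧
          (∀ d, s₄.nat 14 0 d = if d = i then (if i ∈ T then 1 else 0) else s₃.nat 14 0 d) ∧
          s₄.real 14 0 0 = s₃.real 14 0 0 + (if i ∈ T then U i * Θ i else 0) ∧
          s₄.real 15 0 0 = s₃.real 15 0 0 + if i ∈ T then U i else 0 := by
        by_cases hiT : i ∈ T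
        · refine ⟨_, Det.ite_true (hcond.2 hiT) ((Det.nset _ _ _ _).seq
            ((Det.rset _ _ _ _).seq (Det.rset _ _ _ _))), ?_, ?_, ?_, ?_, ?_⟩
          · exact (((Keep.refl _ _).setNat (by omega) _ _ _).setReal (by omega) _ _ _).setReal
              (by omega) _ _ _
          · simp [Store.nat_setNat, h15₃]
          · intro d
            simp [Store.nat_setNat, h15₃, hiT]
          · have e1 := hp₃.eval_weightExp 15
            have e2 := hp₃.eval_valueExp 15
            rw [h15₃] at e1 e2
            simp only [weightExp, valueExp, RExp.eval_get, NExp.eval_nvar, NExp.eval_lit, h15₃]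
              at e1 e2
            have hz14 : z ≠ 14 := by omega
            simp [Store.real_setReal, Store.nat_setNat, weightExp, valueExp, hz14, h15₃, hiT, e1, e2]
          · have e1 := hp₃.eval_weightExp 15
            rw [h15₃] at e1
            simp only [weightExp, RExp.eval_get, NExp.eval_nvar, h15₃] at e1
            have hz14 : z ≠ 14 := by omega
            have hs14 : side ≠ 14 := by omega
            simp [Store.real_setReal, Store.nat_setNat, weightExp, hz14, hs14, h15₃, hiT, e1]
        · refine ⟨_, (Det.ite_false (fun h' => hiT (hcond.1 h')) (Det.nset _ _ _ _)).mono (by omega),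
            ?_, ?_, ?_, ?_, ?_⟩
          · exact (Keep.refl _ _).setNat (by omega) _ _ _
          · simp [Store.nat_setNat, h15₃]
          · intro d
            simp [Store.nat_setNat, h15₃, hiT]
          · simp [hiT]
          · simp [hiT]
      obtain ⟨s₄, hdet₄, hk₄, h15₄, hset₄, hnum₄, hden₄⟩ := hstep
      refine ⟨s₄, ((Det.nset _ _ _ _).seq (hdet₃.seq hdet₄)).mono (by omega), h15₄,
        hks₃.trans hk₄, ?_, ?_, ?_⟩
      · intro d hd
        rw [hset₄]
        split_ifs with hdi hiT
        · simpa [hdi] using hiT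
        · simpa [hdi] using hiT
        · rw [h14₃]; exact hset₁ d (by omega)
      · rw [hnum₄, hnum₃, hnum₁, Finset.range_add_one, Finset.filter_insert]
        split_ifs with hiT
        · rw [Finset.sum_insert (by simp)]; ring
        · ring
      · rw [hden₄, hden₃, hden₁, Finset.range_add_one, Finset.filter_insert]
        split_ifs with hiT
        · rw [Finset.sum_insert (by simp)]; ring
        · ring)
    ⟨hk₀, by simp, by simp [hs₀, Store.real_setReal], by simp [hs₀]⟩
  · refine ⟨s', ((Det.rset _ _ _ _).seq ((Det.rset _ _ _ _).seq hdet)).mono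
      (by unfold topSetTime; ring_nf; omega), hk, hset, ?_⟩
    have hTM : (Finset.range M).filter (· ∈ T) = T := by
      rw [Finset.filter_mem_eq_inter, Finset.inter_eq_right.2 (topSet_subset _)]
    simp [revenueExp, revenue, hnum, hden, hTM]


/-- The real variable `10` is a record that some multiplier, kept in the real variable `11`,
attains; a trial never lowers it and makes it cover the crossing tried. -/
theorem HoldsProblem.tryCrossing (h : HoldsProblem side z y M B U Θ s) (hs : side ≤ 1) (hz : z < 10)
    (hy : y < 10) (hb : s.real 10 0 0 ≤ revenue U Θ (topSet M B U Θ (s.real 11 0 0))) :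
    ∃ s', Det O (tryCrossing side z y) (topSetTime M + 7) s s' ∧ Keep 10 s s' ∧
      s'.nat 11 0 0 = s.nat 11 0 0 ∧ s'.nat 13 0 0 = s.nat 13 0 0 ∧
      s.real 10 0 0 ≤ s'.real 10 0 0 ∧
      revenue U Θ (topSet M B U Θ (crossing U Θ (s.nat 11 0 0) (s.nat 13 0 0))) ≤ s'.real 10 0 0 ∧
      s'.real 10 0 0 ≤ revenue U Θ (topSet M B U Θ (s'.real 11 0 0)) := by
  set l := crossing U Θ (s.nat 11 0 0) (s.nat 13 0 0) with hl
  have hd₁ := Det.rset (O := O) (s := s) 12 (.lit 0) (.lit 0)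
    (.div (.sub (.mul (weightExp side z 11) (valueExp y 11))
      (.mul (weightExp side z 13) (valueExp y 13)))
      (.sub (weightExp side z 11) (weightExp side z 13)))
  simp only [RExp.eval_div, RExp.eval_sub, RExp.eval_mul, h.eval_weightExp, h.eval_valueExp,
    NExp.eval_lit] at hd₁
  rw [show (U (s.nat 11 0 0) * Θ (s.nat 11 0 0) - U (s.nat 13 0 0) * Θ (s.nat 13 0 0)) /
    (U (s.nat 11 0 0) - U (s.nat 13 0 0)) = l from rfl] at hd₁
  set s₁ := s.setReal 12 0 0 l with hs₁
  have hk₁ : Keep 12 s s₁ := (Keep.refl _ _).setReal (by omega) _ _ _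
  obtain ⟨s₂, hd₂, hk₂, -, hrev⟩ :=
    (h.keep hs hz hy (hk₁.anti (by omega))).topSetCmd (O := O) hs hz hy
  have h12 : s₁.real 12 0 0 = l := by simp [hs₁]
  rw [h12] at hrev
  have hk := hk₁.trans (hk₂.anti (by omega))
  have e10 : s₂.real 10 0 0 = s.real 10 0 0 := by rw [hk.2 10 (by omega)]
  have e11 : s₂.real 11 0 0 = s.real 11 0 0 := by rw [hk.2 11 (by omega)]
  have e12 : s₂.real 12 0 0 = l := by rw [hk₂.2 12 (by omega), h12]
  have n11 : s₂.nat 11 0 0 = s.nat 11 0 0 := by rw [hk.1 11 (by omega)]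
  have n13 : s₂.nat 13 0 0 = s.nat 13 0 0 := by
    rw [hk₂.1 13 (by omega), hs₁, Store.nat_setReal]
  by_cases hle : revenue U Θ (topSet M B U Θ l) ≤ s.real 10 0 0
  · refine ⟨s₂, (hd₁.seq (hd₂.seq (Det.ite_false (by simp [hrev, e10, hle]) Det.skip))).mono
      (by omega), hk.anti (by omega), n11, n13, e10.ge, ?_, ?_⟩
    · rw [e10]; exact hle
    · rw [e10, e11]; exact hb
  · refine ⟨_, (hd₁.seq (hd₂.seq (Det.ite_true (by simp [hrev, e10]; exact not_le.1 hle)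
      ((Det.rset _ _ _ _).seq (Det.rset _ _ _ _))))).mono
      (by omega), ?_, n11, n13, ?_, ?_, ?_⟩
    · exact ((hk.anti (by omega)).setReal (by omega) _ _ _).setReal (by omega) _ _ _
    · simp only [Store.real_setReal]
      simp [hrev, (not_le.1 hle).le]
    · simp only [Store.real_setReal]
      simp [hrev]
    · simp only [Store.real_setReal]
      simp [hrev, e12, Store.real_setReal]

/-- The number of steps of `assortCmd`. -/
def assortTime (M : ℕ) : ℕ :=
  (M + 1) * ((M + 1) * (topSetTime M + 10) + 6) + topSetTime M + 8

/-- Both loops run up to `M` inclusive because of the phantom item. Only the best multiplier is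
remembered, so its assortment is recomputed at the end. -/
theorem HoldsProblem.assortCmd (h : HoldsProblem side z y M B U Θ s) (hs : side ≤ 1) (hz : z < 10)
    (hy : y < 10) (hU : ∀ d, 0 ≤ U d) (hΘ : ∀ d < M, 0 ≤ Θ d) (hM : U M = 0) :
    ∃ (s' : Store) (l : ℝ), Det O (assortCmd side z y) (assortTime M) s s' ∧ Keep 10 s s' ∧
      (∀ d < M, s'.nat 14 0 d ≠ 0 ↔ d ∈ topSet M B U Θ l) ∧
      revenueExp.eval s' = revenue U Θ (topSet M B U Θ l) ∧
      ∀ S ⊆ Finset.range M, S.card ≤ B → revenue U Θ S ≤ revenue U Θ (topSet M B U Θ l) := by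
  set R : ℝ → ℝ := fun l => revenue U Θ (topSet M B U Θ l) with hR
  have hk₀ : Keep 10 s (s.setReal 10 0 0 0) := (Keep.refl _ _).setReal (by omega) _ _ _
  have hcount : ∀ s₁, Keep 10 s s₁ → (NExp.add (oppositeCount side) (.lit 1)).eval s₁ = M + 1 :=
    fun s₁ hk => by simp [(h.keep hs hz hy hk).eval_oppositeCount]
  obtain ⟨s₁, hd₁, hk₁, hall, hbest⟩ := Det.forLoop (O := O) (k := 11)
    (N := .add (oppositeCount side) (.lit 1))
    (c := forLoop 13 (.add (oppositeCount side) (.lit 1)) (TwoSided.tryCrossing side z y))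
    (t := (M + 1) * (topSetTime M + 10) + 3) (M := M + 1) (s := s.setReal 10 0 0 0)
    (fun i s₁ => Keep 10 s s₁ ∧
      (∀ b < i, ∀ c < M + 1, R (crossing U Θ b c) ≤ s₁.real 10 0 0) ∧
      s₁.real 10 0 0 ≤ R (s₁.real 11 0 0))
    (fun i s₁ hI => hcount s₁ hI.1)
    (fun i s₁ v hI => ⟨hI.1.setNat (by omega) _ _ _, hI.2⟩)
    (by
      rintro b hb s₁ ⟨hk₁, hall₁, hbest₁⟩ h11
      obtain ⟨s₂, hd₂, hk₂, h11₂, hall₂, hrow, hbest₂⟩ := Det.forLoop (O := O) (k := 13)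
        (N := .add (oppositeCount side) (.lit 1)) (c := TwoSided.tryCrossing side z y)
        (t := topSetTime M + 7) (M := M + 1) (s := s₁)
        (fun j s₂ => Keep 10 s s₂ ∧ s₂.nat 11 0 0 = b ∧
          (∀ b' < b, ∀ c < M + 1, R (crossing U Θ b' c) ≤ s₂.real 10 0 0) ∧
          (∀ c < j, R (crossing U Θ b c) ≤ s₂.real 10 0 0) ∧
          s₂.real 10 0 0 ≤ R (s₂.real 11 0 0))
        (fun j s₂ hI => hcount s₂ hI.1)
        (fun j s₂ v hI => ⟨hI.1.setNat (by omega) _ _ _,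
          by rw [Store.nat_setNat_ne _ (by omega), hI.2.1], hI.2.2⟩)
        (by
          rintro c hc s₂ ⟨hk₂, h11₂, hall₂, hrow₂, hbest₂⟩ h13
          obtain ⟨s₃, hd₃, hk₃, n11, n13, hge, hnew, hbest₃⟩ :=
            (h.keep hs hz hy hk₂).tryCrossing (O := O) hs hz hy hbest₂
          rw [h11₂, h13] at hnew
          refine ⟨s₃, hd₃, by rw [n13, h13], hk₂.trans hk₃, by rw [n11, h11₂],
            fun b' hb' c' hc' => (hall₂ b' hb' c' hc').trans hge, fun c' hc' => ?_, hbest₃⟩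
          rcases Nat.lt_succ_iff_lt_or_eq.1 hc' with h' | rfl
          · exact (hrow₂ c' h').trans hge
          · exact hnew)
        ⟨hk₁, h11, hall₁, by simp, hbest₁⟩
      refine ⟨s₂, hd₂, h11₂, hk₂, fun b' hb' c hc => ?_, hbest₂⟩
      rcases Nat.lt_succ_iff_lt_or_eq.1 hb' with h' | rfl
      · exact hall₂ b' h' c hc
      · exact hrow c hc)
    -- Initially the variable `11` may hold any multiplier; the record `0` is attained because
    -- revenues are nonnegative.
    ⟨hk₀, by simp, by
      simpa using revenue_nonneg hU fun d hd => hΘ d (by simpa using topSet_subset _ hd)⟩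
  · have hk₂ : Keep 10 s (s₁.setReal 12 0 0 (s₁.real 11 0 0)) := hk₁.setReal (by omega) _ _ _
    obtain ⟨s₂, hd₂, hk₃, hset, hrev⟩ := (h.keep hs hz hy hk₂).topSetCmd (O := O) hs hz hy
    rw [Store.real_setReal_self] at hset hrev
    refine ⟨s₂, s₁.real 11 0 0, ((Det.rset _ _ _ _).seq (hd₁.seq
      ((Det.rset _ _ _ _).seq hd₂))).mono (by unfold assortTime; ring_nf; omega),
      hk₂.trans (hk₃.anti (by omega)), hset, hrev, fun S hS hc => ?_⟩
    obtain ⟨b, hb, c, hc', hopt⟩ := exists_crossing_optimal (K := B) hU hΘ hM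
    exact (hopt S hS hc).trans ((hall b (by omega) c (by omega)).trans hbest)


end correct

/-! ### The two-way constrained setting -/

section twoWay
variable {u : Agent n m → Agent n m → ℝ} {K : Agent n m → ℕ} {O : Oracles n m} {s : Store}

/-- `assortCmd` solves the assortment optimization problem of an agent. -/
theorem assortCmd_spec (hu : ∀ a b, 0 ≤ u a b) {z y : ℕ} (hz : z < 10) (hy : y < 10)
    {a : Agent n m} (hk : Keep 2 (input K u) s) (hsz : s.nat z 0 0 = number a)
    (hθ : ∀ c ∈ opposite a, 0 ≤ s.real y 0 (number c)) :
    ∃ s', Det O (assortCmd (sideOf a) z y) (assortTime (n + m)) s s' ∧ Keep 10 s s' ∧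
      (readSet s' a 14 0).card ≤ K a ∧
      (∀ S ⊆ opposite a, S.card ≤ K a → ∑ c ∈ S, s.real y 0 (number c) * mnl u a S (some c) ≤
        ∑ c ∈ readSet s' a 14 0,
          s.real y 0 (number c) * mnl u a (readSet s' a 14 0) (some c)) ∧
      revenueExp.eval s' = ∑ c ∈ readSet s' a 14 0,
          s.real y 0 (number c) * mnl u a (readSet s' a 14 0) (some c) := by
  have hs := sideOf_le a
  set M := sideCard n m (1 - sideOf a) with hMdef
  set U : ℕ → ℝ := s.real (sideOf a) (number a) with hUdef
  set Θ : ℕ → ℝ := s.real y 0 with hΘdef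
  have hUin : ∀ d, U d = (agentAt n m (1 - sideOf a) d).elim 0 (u a) := fun d => by
    rw [hUdef, hk.2 _ (by omega)]
    simp only [input, agentAt_number]
    cases agentAt n m (1 - sideOf a) d <;> rfl
  have hUa : ∀ c ∈ opposite a, U (number c) = u a c := fun c hc => by
    rw [hUin, ← mem_opposite.1 hc, agentAt_number]; rfl
  have hU : ∀ d, 0 ≤ U d := fun d => by
    rw [hUin]
    cases agentAt n m (1 - sideOf a) d
    · exact le_rfl
    · exact hu a _
  -- The phantom item is the cell behind the last agent, where the input weight is zero.
  have hUM : U M = 0 := by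
    have hnone : agentAt n m (1 - sideOf a) M = none := by
      cases a <;> simp [agentAt, sideOf, hMdef, sideCard]
    rw [hUin, hnone]; rfl
  have hΘ : ∀ d < M, 0 ≤ Θ d := fun d hd => by
    obtain ⟨c, hc, hcd⟩ := exists_agent (n := n) (m := m) (side := 1 - sideOf a) (by omega) hd
    rw [← hcd]
    exact hθ c (mem_opposite.2 hc)
  have hprob : HoldsProblem (sideOf a) z y M (K a) U Θ s :=
    ⟨by rw [hk.1 0 (by omega), input_count K u (by omega)], by rw [hsz], rfl,
      by rw [hsz, hk.1 1 (by omega), input_bound]⟩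
  obtain ⟨s', l, hdet, hkeep, hset, hrev, hopt⟩ := hprob.assortCmd (O := O) hs hz hy hU hΘ hUM
  have hinj : ∀ S ⊆ opposite a, Set.InjOn number (S : Set (Agent n m)) := fun S hS b hb c hc h =>
    number_inj (by rw [mem_opposite.1 (hS hb), mem_opposite.1 (hS hc)]) h
  have hrevS : ∀ S ⊆ opposite a,
      ∑ c ∈ S, Θ (number c) * mnl u a S (some c) = revenue U Θ (S.image number) := by
    intro S hS
    rw [sum_mul_mnl, revenue, Finset.sum_image (hinj S hS), Finset.sum_image (hinj S hS)]
    congr 1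
    · exact Finset.sum_congr rfl fun c hc => by rw [hUa c (hS hc)]
    · congr 1
      exact Finset.sum_congr rfl fun c hc => (hUa c (hS hc)).symm
  have himage : ∀ S ⊆ opposite a, S.image number ⊆ Finset.range M := by
    intro S hS d hd
    obtain ⟨c, hc, rfl⟩ := Finset.mem_image.1 hd
    have := number_lt c
    rw [mem_opposite.1 (hS hc)] at this
    simpa using this
  set T := readSet s' a 14 0 with hT
  have hTo : T ⊆ opposite a := readSet_subset _ _ _ _
  have hTimage : T.image number = topSet M (K a) U Θ l := by
    ext d
    constructor
    · intro hd
      have hdM := himage T hTo hd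
      obtain ⟨c, hc, rfl⟩ := Finset.mem_image.1 hd
      exact (hset _ (by simpa using hdM)).1 (mem_readSet.1 hc).2
    · intro hd
      have hdM : d < M := by simpa using topSet_subset l hd
      obtain ⟨c, hc, rfl⟩ := exists_agent (n := n) (m := m) (side := 1 - sideOf a) (by omega) hdM
      exact Finset.mem_image_of_mem _ (mem_readSet.2 ⟨mem_opposite.2 hc, (hset _ hdM).2 hd⟩)
  refine ⟨s', hdet.mono ?_, hkeep, ?_, fun S hS hc => ?_, ?_⟩
  · have : M ≤ n + m := sideCard_le _ _ _
    unfold assortTime topSetTime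
    gcongr
  · rw [← Finset.card_image_of_injOn (hinj T hTo), hTimage]
    exact card_topSet_le l
  · rw [hrevS S hS, hrevS T hTo, hTimage]
    exact hopt _ (himage S hS) (by rwa [Finset.card_image_of_injOn (hinj S hS)])
  · rw [hrev, hrevS T hTo, hTimage]

/-- Store the indicator function of the backlog of the current responder in row `0` of the real
array `6`. -/
def maskCmd (side : ℕ) : Cmd :=
  forLoop 8 (.get 0 (.lit 0) (.lit side))
    (.ite (.nle (.lit 1) (.get 2 backlogRow (nvar 8))) (.rset 6 (.lit 0) (nvar 8) .one)
      (.rset 6 (.lit 0) (nvar 8) .zero))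

theorem maskCmd_spec {side : ℕ} (hs : side ≤ 1) {h : History n m} {b : Agent n m}
    (hb : sideOf b = 1 - side) (hT : Tracks (input K u) side h s) (h5 : s.nat 5 0 0 = number b) :
    ∃ s', Det O (maskCmd side) ((n + m) * 5 + 3) s s' ∧ Keep 6 s s' ∧
      ∀ c ∈ opposite b, s'.real 6 0 (number c) = if c ∈ backlog h b then 1 else 0 := by
  obtain ⟨s', hdet, hk, hmask⟩ := Det.forLoop (O := O) (k := 8)
    (N := .get 0 (.lit 0) (.lit side))
    (c := .ite (.nle (.lit 1) (.get 2 backlogRow (nvar 8))) (.rset 6 (.lit 0) (nvar 8) .one)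
      (.rset 6 (.lit 0) (nvar 8) .zero)) (t := 2) (M := sideCard n m side) (s := s)
    (fun i s₁ => Keep 6 s s₁ ∧ ∀ c ∈ opposite b, number c < i →
      s₁.real 6 0 (number c) = if c ∈ backlog h b then 1 else 0)
    (fun i s₁ hI => by
      simp only [NExp.eval_get, NExp.eval_lit]
      rw [hI.1.1 0 (by omega), hT.1.1 0 (by omega), input_count K u hs])
    (fun i s₁ v hI => ⟨hI.1.setNat (by omega) _ _ _, hI.2⟩)
    (by
      rintro i hi s₁ ⟨hk₁, hmask₁⟩ h8
      have hcond : (BExp.nle (.lit 1) (.get 2 backlogRow (nvar 8))).Holds s₁ ↔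
          s.nat 2 (number b + 1) i ≠ 0 := by
        simp [backlogRow, h8, hk₁.1 2 (by omega), hk₁.1 5 (by omega), h5, Nat.one_le_iff_ne_zero]
      have hmem : ∀ c ∈ opposite b, c ∈ backlog h b ↔ s.nat 2 (number b + 1) (number c) ≠ 0 :=
        fun c hc => by rw [← hT.2 b hb, mem_readSet, and_iff_right hc]
      by_cases hi0 : s.nat 2 (number b + 1) i ≠ 0
      · refine ⟨_, Det.ite_true (hcond.2 hi0) (Det.rset _ _ _ _), h8,
          hk₁.setReal (by omega) _ _ _, fun c hc hci => ?_⟩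
        simp only [NExp.eval_lit, NExp.eval_nvar, h8, Store.real_setReal, true_and]
        by_cases hc' : number c = i
        · rw [if_pos hc', if_pos ((hmem c hc).2 (by rw [hc']; exact hi0))]; rfl
        · rw [if_neg hc']; exact hmask₁ c hc (by omega)
      · refine ⟨_, Det.ite_false (fun h' => hi0 (hcond.1 h')) (Det.rset _ _ _ _), h8,
          hk₁.setReal (by omega) _ _ _, fun c hc hci => ?_⟩
        simp only [NExp.eval_lit, NExp.eval_nvar, h8, Store.real_setReal, true_and]
        by_cases hc' : number c = i
        · rw [if_pos hc', if_neg (fun h' => hi0 (by rw [← hc']; exact (hmem c hc).1 h'))]; rfl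
        · rw [if_neg hc']; exact hmask₁ c hc (by omega))
    ⟨Keep.refl _ _, fun _ _ h' => by omega⟩
  refine ⟨s', hdet.mono (by have := sideCard_le n m side; omega), hk, fun c hc => hmask c hc ?_⟩
  have := number_lt c
  rw [mem_opposite] at hc
  rwa [hc, hb, Nat.sub_sub_self hs] at this

/-- Compute the value of the backlog of the current responder, without (in the variable `7`) and
with the current initiator. -/
def twoWayVal (side : ℕ) : Cmd :=
  .seq (maskCmd side) (.seq (assortCmd (1 - side) 5 6) (.seq (.rset 7 (.lit 0) (.lit 0) revenueExp)
    (.seq (.rset 6 (.lit 0) (nvar 4) .one) (assortCmd (1 - side) 5 6))))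

/-- Compute an optimal assortment for the current responder. -/
def twoWayRespond (side : ℕ) : Cmd := .seq (maskCmd side) (assortCmd (1 - side) 5 6)

/-- The greedy program for the two-way constrained setting. -/
def twoWayProgram (side : ℕ) : Cmd :=
  greedyProgram side (twoWayVal side) (.sub revenueExp (rvar 7)) (assortCmd side 4 2) 14 (.lit 0)
    (twoWayRespond side) 14 (.lit 0)

/-- `assortCmd` computes the value of a backlog. -/
theorem assortCmd_backlog (hu : ∀ a b, 0 ≤ u a b) {b : Agent n m} {A : Finset (Agent n m)}
    (hA : A ⊆ opposite b) (hk : Keep 2 (input K u) s) (h5 : s.nat 5 0 0 = number b)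
    (hmask : ∀ c ∈ opposite b, s.real 6 0 (number c) = if c ∈ A then 1 else 0) :
    ∃ s', Det O (assortCmd (sideOf b) 5 6) (assortTime (n + m)) s s' ∧ Keep 10 s s' ∧
      (readSet s' b 14 0).card ≤ K b ∧
      ∑ c ∈ readSet s' b 14 0, (if c ∈ A then 1 else 0) * mnl u b (readSet s' b 14 0) (some c) =
        mnlValue u K b A ∧
      revenueExp.eval s' = mnlValue u K b A := by
  obtain ⟨s', hdet, hkeep, hcard, hopt, hrev⟩ := assortCmd_spec (O := O) hu (z := 5) (y := 6)
    (by omega) (by omega) hk h5 fun c hc => by rw [hmask c hc]; split_ifs <;> norm_num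
  have hsum : ∑ c ∈ readSet s' b 14 0,
      s.real 6 0 (number c) * mnl u b (readSet s' b 14 0) (some c) =
      ∑ c ∈ readSet s' b 14 0,
        (if c ∈ A then 1 else 0) * mnl u b (readSet s' b 14 0) (some c) :=
    Finset.sum_congr rfl fun c hc => by rw [hmask c (readSet_subset _ _ _ _ hc)]
  have heq : ∑ c ∈ readSet s' b 14 0,
      (if c ∈ A then 1 else 0) * mnl u b (readSet s' b 14 0) (some c) = mnlValue u K b A := by
    -- No assortment within the bound exceeds the value of the backlog `A`, and an optimal one for
    -- the indicator of `A` reaches it, being at least as good as a heaviest subset of `A`.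
    refine le_antisymm (sum_indicator_mul_mnl_le hu b (· ∈ A) (fun c _ hc => hc) hcard) ?_
    rw [← hsum]
    exact mnlValue_le_of_optimal hA (fun c hc => by rw [hmask c (hA hc), if_pos hc]) hopt
  exact ⟨s', hdet, hkeep, hcard, heq, by rw [hrev, hsum, heq]⟩

/-- Backlog values are themselves optima of assortment problems with 0/1 values, so one solver
serves initiators and responders and yields the marginal values. -/
theorem subroutines_twoWay (hu : ∀ a b, 0 ≤ u a b) {side : ℕ} (hs : side ≤ 1) :
    Subroutines O (mnl u) K (twoWay K) (mnlValue u K) (input K u) side (twoWayVal side)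
      (.sub revenueExp (rvar 7)) (assortCmd side 4 2) 14 (.lit 0) (twoWayRespond side) 14 (.lit 0)
      ((n + m) * 5 + 2 * assortTime (n + m) + 9) (assortTime (n + m))
      ((n + m) * 5 + assortTime (n + m) + 4) where
  val h s a b ha hb han hT h4 h5 := by
    have hab : a ∈ opposite b := mem_opposite.2 (by omega)
    obtain ⟨s₁, hd₁, hk₁, hm₁⟩ := maskCmd_spec (O := O) hs hb hT h5
    have h5₁ : s₁.nat 5 0 0 = number b := by rw [hk₁.1 5 (by omega), h5]
    obtain ⟨s₂, hd₂, hk₂, -, -, hv₂⟩ := assortCmd_backlog (O := O) hu (backlog_subset h b)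
      (hT.1.trans (hk₁.anti (by omega))) h5₁ hm₁
    have hk₁₂ := hk₁.trans (hk₂.anti (by omega))
    have h4₂ : s₂.nat 4 0 0 = number a := by rw [hk₁₂.1 4 (by omega), h4]
    -- Setting one more entry of the indicator adds `a` to the backlog for the second optimization,
    -- without touching the stored backlogs.
    set s₃ := (s₂.setReal 7 0 0 (mnlValue u K b (backlog h b))).setReal 6 0 (number a) 1 with hs₃
    have hk₃ : Keep 6 s₂ s₃ :=
      ((Keep.refl _ _).setReal (by omega) _ _ _).setReal (by omega) _ _ _
    have hd₃ : Det O (.rset 7 (.lit 0) (.lit 0) revenueExp) 1 s₂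
        (s₂.setReal 7 0 0 (mnlValue u K b (backlog h b))) := by
      have := Det.rset (O := O) (s := s₂) 7 (.lit 0) (.lit 0) revenueExp
      rwa [hv₂] at this
    have hd₄ : Det O (.rset 6 (.lit 0) (nvar 4) .one) 1
        (s₂.setReal 7 0 0 (mnlValue u K b (backlog h b))) s₃ := by
      have := Det.rset (O := O) (s := s₂.setReal 7 0 0 (mnlValue u K b (backlog h b))) 6
        (.lit 0) (nvar 4) .one
      simpa [h4₂] using this
    have hm₃ : ∀ c ∈ opposite b,
        s₃.real 6 0 (number c) = if c ∈ insert a (backlog h b) then 1 else 0 := by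
      intro c hc
      have hca : number c = number a ↔ c = a :=
        ⟨fun h' => number_inj (by rw [mem_opposite.1 hc, mem_opposite.1 hab]) h',
          fun h' => by rw [h']⟩
      rw [hs₃, Store.real_setReal, Store.real_setReal_ne _ (by omega), hk₂.2 6 (by omega),
        hm₁ c hc]
      by_cases hc' : c = a
      · simp [hc']
      · simp [hc', hca]
    obtain ⟨s₄, hd₅, hk₄, -, -, hv₄⟩ := assortCmd_backlog (O := O) (s := s₃) hu
      (Finset.insert_subset hab (backlog_subset h b))
      (hT.1.trans ((hk₁₂.trans hk₃).anti (by omega)))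
      (by rw [hk₃.1 5 (by omega), hk₁₂.1 5 (by omega), h5]) hm₃
    rw [hb] at hd₂ hd₅
    refine ⟨s₄, (hd₁.seq (hd₂.seq (hd₃.seq (hd₄.seq hd₅)))).mono (by omega),
      (hk₁₂.trans hk₃).trans (hk₄.anti (by omega)), ?_⟩
    rw [RExp.eval_sub, hv₄, RExp.eval_rvar, hk₄.2 7 (by omega), hs₃,
      Store.real_setReal_ne _ (by omega), Store.real_setReal_self]
  select s a ha hk h4 hθ := by
    obtain ⟨s', hdet, hkeep, hcard, hopt, -⟩ := assortCmd_spec (O := O) hu (z := 4) (y := 2)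
      (by omega) (by omega) hk h4 hθ
    rw [ha] at hdet
    exact ⟨s', hdet, hkeep.anti (by omega), hcard, hopt⟩
  respond h s b hb hT h5 := by
    obtain ⟨s₁, hd₁, hk₁, hm₁⟩ := maskCmd_spec (O := O) hs hb hT h5
    have h5₁ : s₁.nat 5 0 0 = number b := by rw [hk₁.1 5 (by omega), h5]
    obtain ⟨s₂, hd₂, hk₂, hcard, hval, -⟩ := assortCmd_backlog (O := O) hu (backlog_subset h b)
      (hT.1.trans (hk₁.anti (by omega))) h5₁ hm₁
    rw [hb] at hd₂
    refine ⟨s₂, (hd₁.seq hd₂).mono (by omega), hk₁.trans (hk₂.anti (by omega)), hcard, ?_⟩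
    rw [← hval, NExp.eval_lit]
    refine (Finset.sum_congr rfl fun c hc => ?_).le
    have : c ∈ backlog h b ↔ h c = some (some b) := by
      rw [mem_backlog, and_iff_right (readSet_subset _ _ _ _ hc)]
    simp only [this]

end twoWay

/-- A bound for the number of steps of `assortCmd`. -/
def assortPoly : Polynomial ℕ :=
  (.X + 1) * ((.X + 1) * (.X * (.X * 5 + 15) + 7 + 10) + 6) + (.X * (.X * 5 + 15) + 7) + 8

theorem exists_twoWayProgram (reg : Regime) : ∃ (P : Cmd) (q : Polynomial ℕ),
    ∀ (n m : ℕ) (K : Agent n m → ℕ) (u : Agent n m → Agent n m → ℝ),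
      (∀ a, 0 < K a) → (∀ a b, 0 ≤ u a b) →
      ∃ π : Policy n m,
        Realizes (noOracles n m) (q.eval (n + m)) [P] (input K u) π ∧
        IsApprox (mnl u) (twoWay K) reg reg.factor π := by
  refine ⟨regimeProgram twoWayProgram reg,
    .X * (.X * (.X * 5 + 2 * assortPoly + 9 + 5) + assortPoly + 11) +
      (.X * (.X * 5 + assortPoly + 4 + 5) + 10) + 3, fun n m K u _ hu => ?_⟩
  have hq : (.X * (.X * (.X * 5 + 2 * assortPoly + 9 + 5) + assortPoly + 11) +
      (.X * (.X * 5 + assortPoly + 4 + 5) + 10) + 3 : Polynomial ℕ).eval (n + m) =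
      greedyTime (n + m) ((n + m) * 5 + 2 * assortTime (n + m) + 9) (assortTime (n + m))
        ((n + m) * 5 + assortTime (n + m) + 4) + 3 := by
    have : assortPoly.eval (n + m) = assortTime (n + m) := by
      simp [assortPoly, assortTime, topSetTime]
    simp [greedyTime, this]
  rw [hq]
  refine regimeProgram_isApprox reg (isChoiceModel_mnl hu) (valuation_twoWay hu)
    (by simp [input]) ?_
  intro side hs _ reg' hreg' s hk h2
  exact (subroutines_twoWay hu hs).greedyProgram (isChoiceModel_mnl hu) (valuation_twoWay hu)
    (fun h a S _ hc _ => hc) hs (fun i hi => input_count K _ hi) hreg' hk h2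

end

end TwoSided

theorem corollary3 :
    -- two-way constrained setting, MNL choice models with the given nonnegative weights `u`
    (∀ r : Regime, ∃ (P : Cmd) (q : Polynomial ℕ),
      ∀ (n m : ℕ) (K : Agent n m → ℕ) (u : Agent n m → Agent n m → ℝ),
        (∀ a, 0 < K a) → (∀ a b, 0 ≤ u a b) →
        ∃ π : Policy n m,
          Realizes (noOracles n m) (q.eval (n + m)) [P] (input K u) π ∧
          IsApprox (mnl u) (twoWay K) r r.factor π) ∧
    -- one-way constrained setting, general choice models accessed through oracles
    (∀ r : Regime, ∃ (P : Cmd) (q : Polynomial ℕ),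
      ∀ (n m : ℕ) (K : Agent n m → ℕ) (φ : Choice n m)
        (best : Agent n m → (Agent n m → ℝ) → Finset (Agent n m)),
        (∀ a, 0 < K a) → IsChoiceModel φ → MonotoneSubmodularDemand φ →
        SolvesConstrainedAssortment φ K r best →
        ∃ π : Policy n m,
          Realizes ⟨φ, best⟩ (q.eval (n + m)) [P] (inputWithoutWeights K) π ∧
          IsApprox φ (oneWay φ K) r r.factor π) :=
  ⟨exists_twoWayProgram, exists_oneWayProgram⟩
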